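/- Let $P=\{p(i)\}_{i\ge 0}$ be a probability mass function on the nonnegative integers, let $T\ge 0$ be a real random variable with Laplace–Stieltjes transform $A(s)=\mathbb E[e^{-sT}]$, and for a binary prefix code with codeword lengths $N=\{n(i)\}$ put $$f(N,s)=A(s)\sum_{i=0}^\infty p(i)e^{s\,n(i)}\in[0,\infty],\qquad s^*(N)=\max\{s\in\mathbb R: f(N,s)\le 1\}.$$ A code is called optimal if $s^*(N)$ exists and $f(N',s)>1$ for every binary prefix code $N'$ and every $s>s^*(N)$; that is, no code has a larger exponent. (The probability of overflow of a buffer of $b$ bits, for source symbols drawn from $P$ with independent intermission times distributed as $T$, is of the order of $e^{-s^*b}$.) Consider the following procedure, started at a real number $s_0>0$. For $j=1,2,\dots$: choose a binary prefix code with lengths $N_j$ minimizing $\sum_i p(i)e^{s_{j-1}n(i)}$ among all binary prefix codes (if $s_{j-1}=0$: minimizing the expected length $\sum_i p(i)n(i)$); compute $s_j=\max\{s\in\mathbb R:f(N_j,s)\le 1\}$; if $s_j=s_{j-1}$, stop with the code $N_j$, otherwise continue with $j+1$. Suppose that one of the following holds: 1. $P$ is geometric: $p(i)=(1-\theta)\theta^i$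 for all $i$, for some $\theta\in(0,1)$ ($s_0>0$ is arbitrary); 2. $s_0$ is an upper bound on $s^*$, that is, $f(N,s)>1$ for every binary prefix code $N$ and every $s>s_0$, and, with $a=e^{s_0}$, there is an integer $r\ge 0$ such that for all $j>r$ and $i<j$ one has $p(i)\ge p(j)$ and $p(i)\ge\sum_{k=j+1}^\infty p(k)a^{k-j}$. Then the procedure terminates with an optimal code: for every choice of minimizers, each step can be carried out (the minimizer and the maximum exist), the procedure stops after finitely many passes, and the code with which it stops is optimal. -/

import Mathlib

open MeasureTheory
open scoped ENNReal

/-- A binary prefix code for the source alphabet `{0, 1, 2, …}`: no codeword is a prefix of the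
codeword of another symbol. -/
structure PrefixCode where
  /-- The codeword of each symbol. -/
  word : ℕ → List Bool
  prefix_free : ∀ i j, word i <+: word j → i = j

/-- The length `n(i)` of the codeword of symbol `i`. -/
def PrefixCode.len (C : PrefixCode) (i : ℕ) : ℕ := (C.word i).length

/-- The sum `∑ p(i) e^{s n(i)}`, with values in `[0, ∞]`. -/
noncomputable def expSum (p : PMF ℕ) (C : PrefixCode) (s : ℝ) : ℝ≥0∞ :=
  ∑' i, p i * ENNReal.ofReal (Real.exp (s * C.len i))

/-- The expected codeword length `∑ p(i) n(i)`, with values in `[0, ∞]`. -/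
noncomputable def meanLen (p : PMF ℕ) (C : PrefixCode) : ℝ≥0∞ :=
  ∑' i, p i * (C.len i : ℝ≥0∞)

/-- `C` minimizes the exponential penalty with parameter `a = e^s`, `s ≥ 0`, among all binary prefix
codes. For `s > 0` this means that it minimizes `∑ p(i) e^{s n(i)}`; for `s = 0`, that is `a = 1`,
the penalty is its limit as `a → 1`, the expected codeword length. -/
def MinimizesPenalty (p : PMF ℕ) (s : ℝ) (C : PrefixCode) : Prop :=
  if s = 0 then ∀ C' : PrefixCode, meanLen p C ≤ meanLen p C'
  else ∀ C' : PrefixCode, expSum p C s ≤ expSum p C' s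

/-- The Laplace–Stieltjes transform `A(s) = 𝔼[e^{-sT}]` of a random variable `T` with law `ν`. -/
noncomputable def laplaceStieltjes (ν : Measure ℝ) (s : ℝ) : ℝ≥0∞ :=
  ∫⁻ t, ENNReal.ofReal (Real.exp (-s * t)) ∂ν

/-- The function `f(N, s) = A(s) ∑ p(i) e^{s n(i)}`. -/
noncomputable def overflowFn (p : PMF ℕ) (ν : Measure ℝ) (C : PrefixCode) (s : ℝ) : ℝ≥0∞ :=
  laplaceStieltjes ν s * expSum p C s

/-- The set of `s` with `f(N, s) ≤ 1`. Its greatest element is the exponent `s*` of `C`. -/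
def feasible (p : PMF ℕ) (ν : Measure ℝ) (C : PrefixCode) : Set ℝ :=
  {s | overflowFn p ν C s ≤ 1}

/-- `sstar` is the buffer-overflow exponent `s*` of the code `C`: the largest `s` with
`f(N, s) ≤ 1`. -/
def IsExponent (p : PMF ℕ) (ν : Measure ℝ) (C : PrefixCode) (sstar : ℝ) : Prop :=
  IsGreatest (feasible p ν C) sstar

/-- `s₀` is an upper bound on the exponent `s*`, whatever code is used. -/
def IsExponentBound (p : PMF ℕ) (ν : Measure ℝ) (s₀ : ℝ) : Prop :=
  ∀ C : PrefixCode, s₀ ∈ upperBounds (feasible p ν C)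

/-- `C` is an optimal code: it has an exponent `s*`, and no code admits a larger one. -/
def IsOptimalCode (p : PMF ℕ) (ν : Measure ℝ) (C : PrefixCode) : Prop :=
  ∃ sstar, IsExponent p ν C sstar ∧ IsExponentBound p ν sstar

/-- One pass through the loop of the procedure, entered with the value `s` (that is `s_{j-1}`): a
code `C` (that is `N_j`) minimizing the penalty for `s` is chosen, and its exponent `s'`
(that is `s_j`) is computed. -/
structure IsPass (p : PMF ℕ) (ν : Measure ℝ) (s : ℝ) (C : PrefixCode) (s' : ℝ) : Prop where
  minimizes : MinimizesPenalty p s C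
  exponent : IsExponent p ν C s'

/-- The values `s` with which the procedure started at `s₀` can enter its loop: `s₀` itself and
every `s_j` that is computed in some pass and differs from `s_{j-1}`. -/
inductive EntersLoop (p : PMF ℕ) (ν : Measure ℝ) (s₀ : ℝ) : ℝ → Prop
  | start : EntersLoop p ν s₀ s₀
  | next {s s' : ℝ} {C : PrefixCode} :
      EntersLoop p ν s₀ s → IsPass p ν s C s' → s' ≠ s → EntersLoop p ν s₀ s'

/-- The procedure started at `s₀` terminates with an optimal code, whichever minimizers it picks:
no pass can get stuck, there is no infinite execution, and whenever the procedure stops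
(a pass returns the value it was entered with) the current code is optimal. -/
structure TerminatesWithOptimalCode (p : PMF ℕ) (ν : Measure ℝ) (s₀ : ℝ) : Prop where
  exists_minimizer : ∀ s, EntersLoop p ν s₀ s → ∃ C, MinimizesPenalty p s C
  exists_exponent : ∀ s C, EntersLoop p ν s₀ s → MinimizesPenalty p s C →
    ∃ s', IsExponent p ν C s'
  no_infinite_run : ¬ ∃ (s : ℕ → ℝ) (C : ℕ → PrefixCode), s 0 = s₀ ∧
    ∀ j, IsPass p ν (s j) (C (j + 1)) (s (j + 1)) ∧ s (j + 1) ≠ s j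
  optimal_of_stop : ∀ s C, EntersLoop p ν s₀ s → IsPass p ν s C s → IsOptimalCode p ν C

/-- A geometric source: `p(i) = (1 - θ) θ^i` for some `θ ∈ (0, 1)`. -/
def IsGeometricSource (p : PMF ℕ) : Prop :=
  ∃ θ : ℝ, 0 < θ ∧ θ < 1 ∧ ∀ i, p i = ENNReal.ofReal ((1 - θ) * θ ^ i)

/-- The light-tail condition for the exponential penalty with base `a`: for some `r`, all `j > r`
and all `i < j`, `p(i) ≥ p(j)` and `p(i) ≥ ∑_{k ≥ j+1} p(k) a^{k-j}`. -/
def IsLightTailed (p : PMF ℕ) (a : ℝ) : Prop :=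
  ∃ r : ℕ, ∀ j > r, ∀ i < j,
    p j ≤ p i ∧ ∑' m : ℕ, p (j + 1 + m) * ENNReal.ofReal (a ^ (m + 1)) ≤ p i

/-!
Everything takes place at the level of codeword lengths. By Kraft's inequality and its converse
(`PrefixCode.kraftLE`, `KraftLE.exists_prefixCode`) a pass minimizes `∑ p(i) φ(n(i))` over the
lengths `n` with `∑ 2^{-n(i)} ≤ 1`, where `φ(n) = 1 + b + ⋯ + b^{n-1}` and `b = e^s`; this
normalization of the penalty includes the expected length as the case `b = 1`. Four facts give the
theorem.

*Existence.* A minimizer exists by compactness if all `p(i)` are positive, and because only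
finitely many lengths compete if only finitely many `p(i)` are; a light-tailed source is of one of
these two kinds. Exponents exist because `{s | f(N, s) ≤ 1}` is closed by Fatou's lemma, contains
`0`, and is bounded, either by `s₀` or because geometric codes have arbitrarily long codewords.

*Stopping.* `f(N, s) = 𝔼 e^{s (n(X) - T)}` is strictly convex in `s` with `f(N, 0) = 1`, unless
`n(X) = T` almost surely, in which case every `s` would be feasible. If some code `N'` had an
exponent larger than the value `s > 0` at which the procedure stops, then `f(N', s) < 1`, hence
`f(N, s) < 1` for the minimizer `N`; if `f(N, ·)` is finite a little to the right of `s`, it is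
continuous at `s` and `s` is not its exponent. For `s = 0` the derivative at `0` takes the place of
the value at `s` (`isExponentBound_of_stop`).

*Structure of minimizers.* Lengthening the codewords of a set of symbols by one pays for shortening
another codeword, and conversely (`IsOptLen.shorten_le`, `IsOptLen.le_lengthen`). For a
light-tailed source and `b < e^{s₀}` these exchanges show that the lengths of every minimizer
eventually satisfy, up to exchanging equally likely symbols, `n(j+1) = n(j) + 1`
(`LightTail.exists_perm_unary`). For a geometric source with ratio `θ` and
`θ^{k+1} b (1 + θ) < 1 < θ^k b (1 + θ)`, they show that the lengths of every minimizer eventually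
satisfy `n(i+k+1) = n(i) + 1` (`IsGeomWeight.add_period`). The finiteness of `f(N, ·)` to the right
of `s` needed for stopping follows from the unary tail for a light-tailed source with `s < s₀`
(at `s = s₀` the assumed bound suffices), and from a comparison of tails for a geometric source at
any base, including those where two periods tie (`IsGeomWeight.exists_gt_summable`).

*Termination.* The exponents `s_1 < s_2 < ⋯` of an infinite run are bounded, hence converge to some
`S`. Minimizers for bases up to `e^S` are bounded symbol by symbol, and just below `e^S` their
tails run with one fixed period from a fixed index on; if only finitely many `p(i)` are positive,
only the lengths of these
symbols matter. So eventually finitely many functions `f(N_j, ·)` occur, while the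
exponents are all different (`IsRun.not_finite`).
-/

/-! ### Kraft's inequality and its converse -/

/-- Codeword lengths satisfying Kraft's inequality `∑ 2^{-n(i)} ≤ 1`. Summability is required
explicitly since a divergent real series has the junk sum `0`. -/
def KraftLE (n : ℕ → ℕ) : Prop :=
  (Summable fun i => (2⁻¹ : ℝ) ^ n i) ∧ ∑' i, (2⁻¹ : ℝ) ^ n i ≤ 1

lemma PrefixCode.word_ne_nil (C : PrefixCode) (i : ℕ) : C.word i ≠ [] := by
  intro h
  have := C.prefix_free i (i + 1) (by rw [h]; exact List.nil_prefix)
  omega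

lemma PrefixCode.word_injective (C : PrefixCode) : Function.Injective C.word := fun i j h =>
  C.prefix_free i j (h ▸ List.prefix_rfl)

lemma PrefixCode.uniquelyDecodable (C : PrefixCode) (S : Set (List Bool))
    (hS : S ⊆ Set.range C.word) : InformationTheory.UniquelyDecodable S := by
  intro L₁
  induction L₁ with
  | nil =>
    intro L₂ _ h₂ h
    cases L₂ with
    | nil => rfl
    | cons w L =>
      obtain ⟨i, hi⟩ := hS (h₂ w (by simp))
      have : w = [] := by simp at h; exact h.1
      exact absurd (hi.trans this) (C.word_ne_nil i)
  | cons v L ih =>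
    intro L₂ h₁ h₂ h
    obtain ⟨i, hi⟩ := hS (h₁ v (by simp))
    cases L₂ with
    | nil =>
      have : v = [] := by simp at h; exact h.1
      exact absurd (hi.trans this) (C.word_ne_nil i)
    | cons w L' =>
      obtain ⟨j, hj⟩ := hS (h₂ w (by simp))
      simp only [List.flatten_cons] at h
      have hvw : v = w := by
        have h1 : v <+: v ++ L.flatten := List.prefix_append _ _
        have h2 : w <+: v ++ L.flatten := h ▸ List.prefix_append _ _
        rcases List.prefix_or_prefix_of_prefix h1 h2 with h3 | h3
        · rw [← hi, ← hj] at h3 ⊢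
          rw [C.prefix_free _ _ h3]
        · rw [← hi, ← hj] at h3 ⊢
          rw [C.prefix_free _ _ h3]
      subst hvw
      rw [List.append_cancel_left_eq] at h
      rw [ih L' (fun x hx => h₁ x (by simp [hx])) (fun x hx => h₂ x (by simp [hx])) h]

/-- Kraft's inequality for a prefix code on a countable alphabet. -/
lemma PrefixCode.kraftLE (C : PrefixCode) : KraftLE C.len := by
  have key : ∀ s : Finset ℕ, ∑ i ∈ s, (2⁻¹ : ℝ) ^ C.len i ≤ 1 := by
    intro s
    have h := InformationTheory.kraft_mcmillan_inequality (S := s.image C.word)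
      (C.uniquelyDecodable _ (by intro w hw; simp at hw; obtain ⟨i, _, h⟩ := hw; exact ⟨i, h⟩))
    rw [Finset.sum_image (fun a _ b _ h => C.word_injective h)] at h
    simpa [PrefixCode.len] using h
  have hs : Summable fun i => (2⁻¹ : ℝ) ^ C.len i :=
    summable_of_sum_le (fun i => by positivity) key
  exact ⟨hs, hs.tsum_le_of_sum_le key⟩

lemma KraftLE.sum_le {n : ℕ → ℕ} (h : KraftLE n) (s : Finset ℕ) :
    ∑ i ∈ s, (2⁻¹ : ℝ) ^ n i ≤ 1 :=
  (h.1.sum_le_tsum s (fun i _ => by positivity)).trans h.2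

lemma KraftLE.finite_le {n : ℕ → ℕ} (h : KraftLE n) (l : ℕ) : {i | n i ≤ l}.Finite := by
  have h1 := h.1.tendsto_cofinite_zero.eventually
    (gt_mem_nhds (show (0 : ℝ) < 2⁻¹ ^ l by positivity))
  refine (Filter.eventually_cofinite.1 h1).subset ?_
  intro i hi
  simp only [Set.mem_ofPred_eq, not_lt] at hi ⊢
  exact pow_le_pow_of_le_one (by norm_num) (by norm_num) hi

/-- The converse of Kraft's inequality. Symbols are ordered by length (ties by index); the codeword
of `i` is the binary expansion, to `n(i)` places, of the total mass `∑ 2^{-n(k)}` of the symbols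
before `i`. -/
lemma KraftLE.exists_prefixCode {n : ℕ → ℕ} (h : KraftLE n) : ∃ C : PrefixCode, C.len = n := by
  classical
  have hfin : ∀ i, {k | n k < n i ∨ n k = n i ∧ k < i}.Finite := fun i =>
    (h.finite_le (n i)).subset (by intro k hk; simp at hk ⊢; omega)
  let S : ℕ → Finset ℕ := fun i => (hfin i).toFinset
  have hS : ∀ i k, k ∈ S i ↔ n k < n i ∨ n k = n i ∧ k < i := fun i k => by simp [S]
  let c : ℕ → ℕ := fun i => ∑ k ∈ S i, 2 ^ (n i - n k)
  have hc1 : ∀ i, c i < 2 ^ n i := by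
    intro i
    have h1 := h.sum_le (insert i (S i))
    rw [Finset.sum_insert (by simp [hS])] at h1
    have h2 : (c i : ℝ) = 2 ^ n i * ∑ k ∈ S i, (2⁻¹ : ℝ) ^ n k := by
      simp only [c, Nat.cast_sum, Finset.mul_sum]
      refine Finset.sum_congr rfl fun k hk => ?_
      have : n k ≤ n i := by rcases (hS i k).1 hk with h | h <;> omega
      push_cast
      rw [pow_sub₀ _ (by norm_num) this, inv_pow]
    have h3 : (c i : ℝ) + 1 ≤ 2 ^ n i := by
      have : (2 : ℝ) ^ n i * 2⁻¹ ^ n i = 1 := by rw [← mul_pow]; norm_num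
      have h4 := mul_le_mul_of_nonneg_left h1 (show (0 : ℝ) ≤ 2 ^ n i by positivity)
      rw [mul_add, this, ← h2] at h4
      linarith
    exact_mod_cast h3
  have hc2 : ∀ i j, i ∈ S j → (c i + 1) * 2 ^ (n j - n i) ≤ c j := by
    intro i j hij
    have hsub : insert i (S i) ⊆ S j := by
      intro k hk
      rw [hS] at hij ⊢
      rcases Finset.mem_insert.1 hk with rfl | hk
      · exact hij
      · rw [hS] at hk; omega
    have hle : n i ≤ n j := by rcases (hS j i).1 hij with h | h <;> omega
    calc (c i + 1) * 2 ^ (n j - n i)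
        = ∑ k ∈ insert i (S i), 2 ^ (n j - n k) := by
          rw [Finset.sum_insert (by simp [hS]), add_mul, one_mul, add_comm]
          simp only [c, Finset.sum_mul]
          congr 1
          refine Finset.sum_congr rfl fun k hk => ?_
          have : n k ≤ n i := by rcases (hS i k).1 hk with h | h <;> omega
          rw [← pow_add]
          congr 1
          omega
      _ ≤ c j := Finset.sum_le_sum_of_subset hsub
  let w : ℕ → List Bool := fun i => List.ofFn fun k : Fin (n i) => (c i).testBit (n i - 1 - k)
  have hlen : ∀ i, (w i).length = n i := fun i => by simp [w]
  refine ⟨⟨w, ?_⟩, funext hlen⟩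
  intro i j hij
  have hle : n i ≤ n j := by simpa [hlen] using hij.length_le
  have hbit : c i = c j / 2 ^ (n j - n i) := by
    refine Nat.eq_of_testBit_eq fun t => ?_
    rw [Nat.testBit_div_two_pow]
    by_cases ht : t < n i
    · have h1 := List.prefix_iff_getElem.1 hij
      obtain ⟨_, h1⟩ := h1
      have h2 := h1 (n i - 1 - t) (by rw [hlen]; omega)
      simp only [w, List.getElem_ofFn] at h2
      have e1 : n i - 1 - (n i - 1 - t) = t := by omega
      have e2 : n j - 1 - (n i - 1 - t) = n j - n i + t := by omega
      rw [e1, e2] at h2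
      rw [h2]
      congr 1
      omega
    · rw [Nat.testBit_lt_two_pow ((hc1 i).trans_le (Nat.pow_le_pow_right (by norm_num) (by omega))),
        Nat.testBit_lt_two_pow ((hc1 j).trans_le (Nat.pow_le_pow_right (by norm_num) (by omega)))]
  by_contra hne
  by_cases hS' : i ∈ S j
  · have := hc2 i j hS'
    have h3 := (Nat.le_div_iff_mul_le (by positivity)).2 this
    omega
  · rw [hS] at hS'
    have h4 : n i = n j ∧ j < i := by omega
    have := hc2 j i ((hS i j).2 (Or.inr ⟨h4.1.symm, h4.2⟩))
    rw [h4.1] at hbit this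
    simp at hbit this
    omega

/-! ### Exchange inequalities for optimal lengths -/

/-- The normalized exponential penalty `1 + b + ⋯ + b^{n-1}` of a codeword of length `n`. It is
`(b^n - 1)/(b - 1)` for `b > 1` and `n` for `b = 1`, so that a single minimization problem covers
both the exponential penalty and the expected length. -/
def penalty (b : ℝ) (n : ℕ) : ℝ := ∑ m ∈ Finset.range n, b ^ m

lemma penalty_succ (b : ℝ) (n : ℕ) : penalty b (n + 1) = penalty b n + b ^ n :=
  Finset.sum_range_succ _ _

lemma pow_eq_penalty (b : ℝ) (n : ℕ) : b ^ n = 1 + (b - 1) * penalty b n := by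
  rw [penalty, mul_comm, geom_sum_mul]; ring

lemma penalty_add (b : ℝ) (m n : ℕ) : penalty b (m + n) = penalty b m + b ^ m * penalty b n := by
  simp only [penalty, Finset.sum_range_add, pow_add, Finset.mul_sum]

lemma penalty_nonneg {b : ℝ} (hb : 1 ≤ b) (n : ℕ) : 0 ≤ penalty b n :=
  Finset.sum_nonneg fun _ _ => by positivity

lemma cast_le_penalty {b : ℝ} (hb : 1 ≤ b) (n : ℕ) : (n : ℝ) ≤ penalty b n := by
  have : ∑ m ∈ Finset.range n, (1 : ℝ) ≤ penalty b n :=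
    Finset.sum_le_sum fun m _ => one_le_pow₀ hb
  simpa using this

lemma penalty_mono {b : ℝ} (hb : 1 ≤ b) {m n : ℕ} (h : m ≤ n) : penalty b m ≤ penalty b n :=
  Finset.sum_le_sum_of_subset_of_nonneg (by simpa using h) fun _ _ _ => by positivity

/-- The lengths `n` have finite cost and minimize the normalized penalty
`∑ p(i) (1 + ⋯ + b^{n(i)-1})` under Kraft's inequality. Competitors of infinite cost are excluded by
a summability hypothesis, as their real series would have the junk sum `0`. -/
structure IsOptLen (p : ℕ → ℝ) (b : ℝ) (n : ℕ → ℕ) : Prop where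
  kraft : KraftLE n
  summable_pow : Summable fun i => p i * b ^ n i
  summable_penalty : Summable fun i => p i * penalty b (n i)
  le : ∀ n', KraftLE n' → Summable (fun i => p i * penalty b (n' i)) →
    ∑' i, p i * penalty b (n i) ≤ ∑' i, p i * penalty b (n' i)

lemma tsum_indicator_range {g : ℕ → ℕ} (hg : Function.Injective g) (f : ℕ → ℝ) :
    ∑' x, (Set.range g).indicator f x = ∑' j, f (g j) := by
  rw [← hg.tsum_eq (f := (Set.range g).indicator f) (by
    intro x hx
    by_contra hxg
    exact hx (Set.indicator_of_notMem hxg f))]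
  simp

lemma KraftLE.of_diff {n n' : ℕ → ℕ} (h : KraftLE n) {d : ℕ → ℝ}
    (hd : ∀ i, (2⁻¹ : ℝ) ^ n' i = 2⁻¹ ^ n i + d i) {a : ℝ} (hs : HasSum d a)
    (ha : ∑' i, (2⁻¹ : ℝ) ^ n i + a ≤ 1) : KraftLE n' := by
  have := h.1.hasSum.add hs
  simp only [← hd] at this
  exact ⟨this.summable, this.tsum_eq.trans_le ha⟩

namespace IsOptLen

variable {p : ℕ → ℝ} {b : ℝ} {n : ℕ → ℕ}

lemma diff_nonneg (h : IsOptLen p b n) {n' : ℕ → ℕ} (hn' : KraftLE n') {d : ℕ → ℝ}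
    (hd : ∀ i, p i * penalty b (n' i) = p i * penalty b (n i) + d i) {a : ℝ} (hs : HasSum d a) :
    0 ≤ a := by
  have := h.summable_penalty.hasSum.add hs
  simp only [← hd] at this
  have h2 := h.le n' hn' this.summable
  rw [this.tsum_eq] at h2
  linarith

lemma length_pos (h : IsOptLen p b n) (i : ℕ) : 1 ≤ n i := by
  by_contra hi
  have h1 := h.kraft.sum_le {i, i + 1}
  rw [Finset.sum_pair (by omega), show n i = 0 by omega] at h1
  have : (0 : ℝ) < 2⁻¹ ^ n (i + 1) := by positivity
  rw [pow_zero] at h1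
  linarith

/-- Shortening the codeword of `i` by one while lengthening the codewords of `S` by one does not
lower the cost, if Kraft's inequality survives. -/
lemma shorten_le (h : IsOptLen p b n) {S : Set ℕ} {i : ℕ} (hi : i ∉ S)
    (hK : ∑' x, (2⁻¹ : ℝ) ^ n x + 2⁻¹ ^ n i ≤
      1 + (∑' x, S.indicator (fun x => (2⁻¹ : ℝ) ^ n x) x) / 2) :
    p i * b ^ (n i - 1) ≤ ∑' x, S.indicator (fun x => p x * b ^ n x) x := by
  classical
  have h1 := h.length_pos i
  let n' : ℕ → ℕ := fun x => if x = i then n i - 1 else if x ∈ S then n x + 1 else n x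
  have hm : HasSum (fun x => (if x = i then (2⁻¹ : ℝ) ^ n i else 0) +
      -(S.indicator (fun x => (2⁻¹ : ℝ) ^ n x) x / 2))
      ((2⁻¹ : ℝ) ^ n i + -((∑' x, S.indicator (fun x => (2⁻¹ : ℝ) ^ n x) x) / 2)) :=
    (hasSum_ite_eq i _).add (((h.kraft.1.indicator S).hasSum.div_const 2).neg)
  have hn' : KraftLE n' := by
    refine h.kraft.of_diff (fun x => ?_) hm (by linarith)
    by_cases hx : x = i
    · subst hx
      obtain ⟨m, hm⟩ : ∃ m, n x = m + 1 := ⟨n x - 1, by omega⟩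
      simp [n', hi, hm, pow_succ]
      ring
    · by_cases hxS : x ∈ S
      · simp [n', hx, hxS, pow_succ]; ring
      · simp [n', hx, hxS]
  have hc : HasSum (fun x => -(if x = i then p i * b ^ (n i - 1) else 0) +
      S.indicator (fun x => p x * b ^ n x) x)
      (-(p i * b ^ (n i - 1)) + ∑' x, S.indicator (fun x => p x * b ^ n x) x) :=
    (hasSum_ite_eq i _).neg.add (h.summable_pow.indicator S).hasSum
  have := h.diff_nonneg hn' (fun x => ?_) hc
  · linarith
  · by_cases hx : x = i
    · subst hx
      obtain ⟨m, hm⟩ : ∃ m, n x = m + 1 := ⟨n x - 1, by omega⟩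
      simp [n', hi, hm, penalty_succ]
      ring
    · by_cases hxS : x ∈ S
      · simp [n', hx, hxS, penalty_succ]; ring
      · simp [n', hx, hxS]

/-- The reverse exchange: lengthening the codeword of `i` by one and shortening those of `S`. -/
lemma le_lengthen (h : IsOptLen p b n) {S : Set ℕ} {i : ℕ} (hi : i ∉ S)
    (hK : ∑' x, S.indicator (fun x => (2⁻¹ : ℝ) ^ n x) x ≤ 2⁻¹ ^ n i / 2) (hb : b ≠ 0) :
    (∑' x, S.indicator (fun x => p x * b ^ n x) x) / b ≤ p i * b ^ n i := by
  classical
  let n' : ℕ → ℕ := fun x => if x = i then n i + 1 else if x ∈ S then n x - 1 else n x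
  have hm : HasSum (fun x => -(if x = i then (2⁻¹ : ℝ) ^ n i / 2 else 0) +
      S.indicator (fun x => (2⁻¹ : ℝ) ^ n x) x)
      (-((2⁻¹ : ℝ) ^ n i / 2) + ∑' x, S.indicator (fun x => (2⁻¹ : ℝ) ^ n x) x) :=
    (hasSum_ite_eq i _).neg.add (h.kraft.1.indicator S).hasSum
  have hn' : KraftLE n' := by
    refine h.kraft.of_diff (fun x => ?_) hm (by linarith [h.kraft.2])
    by_cases hx : x = i
    · subst hx
      simp [n', hi, pow_succ]
      ring
    · by_cases hxS : x ∈ S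
      · obtain ⟨m, hm⟩ : ∃ m, n x = m + 1 := ⟨n x - 1, by have := h.length_pos x; omega⟩
        simp [n', hx, hxS, hm, pow_succ]; ring
      · simp [n', hx, hxS]
  have hc : HasSum (fun x => (if x = i then p i * b ^ n i else 0) +
      -(S.indicator (fun x => p x * b ^ n x) x / b))
      (p i * b ^ n i + -((∑' x, S.indicator (fun x => p x * b ^ n x) x) / b)) :=
    (hasSum_ite_eq i _).add (((h.summable_pow.indicator S).hasSum.div_const b).neg)
  have := h.diff_nonneg hn' (fun x => ?_) hc
  · linarith
  · by_cases hx : x = i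
    · subst hx
      simp [n', hi, penalty_succ]
      ring
    · by_cases hxS : x ∈ S
      · obtain ⟨m, hm⟩ : ∃ m, n x = m + 1 := ⟨n x - 1, by have := h.length_pos x; omega⟩
        simp [n', hx, hxS, hm, penalty_succ, pow_succ]
        field_simp
        ring
      · simp [n', hx, hxS]

/-- Exchange with the image of an injection `g` of Kraft mass at least `2 · 2^{-n(i)}`. -/
lemma shorten_le_range (h : IsOptLen p b n) {g : ℕ → ℕ} (hg : Function.Injective g) {i : ℕ}
    (hi : ∀ j, g j ≠ i) (hK : 2 * (2⁻¹ : ℝ) ^ n i ≤ ∑' j, (2⁻¹ : ℝ) ^ n (g j)) :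
    p i * b ^ (n i - 1) ≤ ∑' j, p (g j) * b ^ n (g j) := by
  have := h.shorten_le (S := Set.range g) (i := i) (by rintro ⟨j, hj⟩; exact hi j hj) (by
    rw [tsum_indicator_range hg]; linarith [h.kraft.2])
  rwa [tsum_indicator_range hg (fun x => p x * b ^ n x)] at this

lemma le_lengthen_range (h : IsOptLen p b n) {g : ℕ → ℕ} (hg : Function.Injective g) {i : ℕ}
    (hi : ∀ j, g j ≠ i) (hK : ∑' j, (2⁻¹ : ℝ) ^ n (g j) ≤ 2⁻¹ ^ n i / 2) (hb : b ≠ 0) :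
    (∑' j, p (g j) * b ^ n (g j)) / b ≤ p i * b ^ n i := by
  have := h.le_lengthen (S := Set.range g) (i := i) (by rintro ⟨j, hj⟩; exact hi j hj) (by
    rwa [tsum_indicator_range hg]) hb
  rwa [tsum_indicator_range hg (fun x => p x * b ^ n x)] at this

/-- If every symbol has positive probability, optimal lengths exhaust Kraft's inequality: otherwise
some long codeword could be shortened. -/
lemma kraft_eq_one (h : IsOptLen p b n) (hp : ∀ i, 0 < p i) (hb : 0 < b) :
    ∑' i, (2⁻¹ : ℝ) ^ n i = 1 := by
  refine le_antisymm h.kraft.2 ?_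
  by_contra hlt
  push Not at hlt
  have h0 := h.kraft.1.tendsto_atTop_zero
  obtain ⟨i, hi⟩ := (h0.eventually (gt_mem_nhds (sub_pos.2 hlt))).exists
  have := h.shorten_le (S := ∅) (i := i) (by simp) (by
    simp only [Set.indicator_empty, tsum_zero]
    linarith)
  simp only [Set.indicator_empty, tsum_zero] at this
  have : 0 < p i * b ^ (n i - 1) := by have := hp i; positivity
  linarith

/-- Rarer symbols do not have shorter codewords. -/
lemma le_of_lt_prob (h : IsOptLen p b n) (hb : 1 ≤ b) {i j : ℕ} (hp : 0 < p j) (hij : p j < p i) :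
    n i ≤ n j := by
  by_contra hlt
  push Not at hlt
  have hne : i ≠ j := by rintro rfl; exact lt_irrefl _ hij
  have e : ∀ f : ℕ → ℝ, ∑' x, ({j} : Set ℕ).indicator f x = f j := by
    intro f
    rw [tsum_eq_single j (by intro x hx; simp [hx])]; simp
  have := h.shorten_le (S := {j}) (i := i) (by simpa using hne) (by
    rw [e (fun x => (2⁻¹ : ℝ) ^ n x)]
    have : (2⁻¹ : ℝ) ^ n i ≤ 2⁻¹ ^ (n j + 1) :=
      pow_le_pow_of_le_one (by norm_num) (by norm_num) hlt
    rw [pow_succ] at this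
    linarith [h.kraft.2])
  rw [e (fun x => p x * b ^ n x)] at this
  have h2 : b ^ n j ≤ b ^ (n i - 1) := pow_le_pow_right₀ hb (by omega)
  have h3 : 0 < b ^ n j := by positivity
  nlinarith

lemma tsum_pow_le (h : IsOptLen p b n) (hb : 1 ≤ b) (hp : Summable p) {n' : ℕ → ℕ}
    (hn' : KraftLE n') (hs : Summable fun i => p i * penalty b (n' i)) :
    (Summable fun i => p i * b ^ n' i) ∧ ∑' i, p i * b ^ n i ≤ ∑' i, p i * b ^ n' i := by
  have e : ∀ n : ℕ → ℕ, (fun i => p i * b ^ n i) =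
      fun i => p i + (b - 1) * (p i * penalty b (n i)) := by
    intro n; funext i; rw [pow_eq_penalty]; ring
  rw [e, e]
  refine ⟨hp.add (hs.mul_left _), ?_⟩
  rw [hp.tsum_add (hs.mul_left _), hp.tsum_add (h.summable_penalty.mul_left _), tsum_mul_left,
    tsum_mul_left]
  have := h.le n' hn' hs
  have : (b - 1) * ∑' i, p i * penalty b (n i) ≤ (b - 1) * ∑' i, p i * penalty b (n' i) :=
    mul_le_mul_of_nonneg_left this (by linarith)
  linarith

/-- Replacing the codewords of all symbols from `m` on by a code `g`, placed below a node at depth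
`l` whose Kraft mass is at most what these symbols occupy, does not lower the cost. -/
lemma tail_le (h : IsOptLen p b n) (hb : 1 ≤ b) (hp : Summable p) {m l : ℕ} {g : ℕ → ℕ}
    (hg : KraftLE g) (hl : (2⁻¹ : ℝ) ^ l ≤ ∑' j, (2⁻¹ : ℝ) ^ n (j + m))
    (hs : Summable fun j => p (j + m) * penalty b (l + g j)) :
    ∑' j, p (j + m) * penalty b (n (j + m)) ≤ ∑' j, p (j + m) * penalty b (l + g j) ∧
    (Summable fun j => p (j + m) * b ^ (l + g j)) ∧
      ∑' j, p (j + m) * b ^ n (j + m) ≤ ∑' j, p (j + m) * b ^ (l + g j) := by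
  let n' : ℕ → ℕ := fun x => if x < m then n x else l + g (x - m)
  have hlt : ∀ x ∈ Finset.range m, n' x = n x := fun x hx => by simp [n', Finset.mem_range.1 hx]
  have hge : ∀ j, n' (j + m) = l + g j := fun j => by simp [n']
  have hK : KraftLE n' := by
    have h1 : Summable fun i => (2⁻¹ : ℝ) ^ n' i := by
      rw [← summable_nat_add_iff m]
      simp only [hge, pow_add]
      exact hg.1.mul_left _
    refine ⟨h1, ?_⟩
    rw [← h1.sum_add_tsum_nat_add m]
    simp only [hge, pow_add, tsum_mul_left]
    have h2 := h.kraft.2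
    rw [← h.kraft.1.sum_add_tsum_nat_add m] at h2
    have h3 : (2⁻¹ : ℝ) ^ l * ∑' j, (2⁻¹ : ℝ) ^ g j ≤ 2⁻¹ ^ l * 1 :=
      mul_le_mul_of_nonneg_left hg.2 (by positivity)
    rw [Finset.sum_congr rfl fun x hx => by rw [hlt x hx]]
    linarith
  have hs' : Summable fun i => p i * penalty b (n' i) := by
    rw [← summable_nat_add_iff m]
    simpa only [hge] using hs
  have h1 := h.le n' hK hs'
  rw [← h.summable_penalty.sum_add_tsum_nat_add m, ← hs'.sum_add_tsum_nat_add m] at h1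
  obtain ⟨h4, h5⟩ := h.tsum_pow_le hb hp hK hs'
  rw [← h.summable_pow.sum_add_tsum_nat_add m, ← h4.sum_add_tsum_nat_add m] at h5
  rw [← summable_nat_add_iff m] at h4
  simp only [hge] at h1 h4 h5
  have e1 : ∑ x ∈ Finset.range m, p x * penalty b (n' x) =
      ∑ x ∈ Finset.range m, p x * penalty b (n x) :=
    Finset.sum_congr rfl fun x hx => by rw [hlt x hx]
  have e2 : ∑ x ∈ Finset.range m, p x * b ^ n' x = ∑ x ∈ Finset.range m, p x * b ^ n x :=
    Finset.sum_congr rfl fun x hx => by rw [hlt x hx]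
  refine ⟨by linarith, h4, by linarith⟩

end IsOptLen

/-! ### Optimal lengths for light tails -/

lemma hasSum_half_pow_succ : HasSum (fun t : ℕ => (2⁻¹ : ℝ) ^ (t + 1)) 1 := by
  have := (hasSum_geometric_of_lt_one (r := (2⁻¹ : ℝ)) (by norm_num) (by norm_num)).mul_right 2⁻¹
  simp only [← pow_succ] at this
  norm_num at this ⊢
  exact this

lemma kraftLE_succ : KraftLE fun t => t + 1 :=
  ⟨hasSum_half_pow_succ.summable, hasSum_half_pow_succ.tsum_eq.le⟩

lemma penalty_le_pow_div {a b : ℝ} (ha : 1 < a) (hb : 1 ≤ b) (hab : b ≤ a) (k : ℕ) :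
    penalty b k ≤ a ^ k / (a - 1) := by
  have h1 : penalty b k ≤ penalty a k :=
    Finset.sum_le_sum fun m _ => pow_le_pow_left₀ (by linarith) hab m
  rw [le_div_iff₀ (by linarith)]
  have := pow_eq_penalty a k
  nlinarith

/-- The light-tail condition with base `a` and threshold `r`, for real weights. Summability is part
of the condition, which in `[0, ∞]` follows from the bound on the sum. -/
structure LightTail (p : ℕ → ℝ) (a : ℝ) (r : ℕ) : Prop where
  antitone : ∀ j > r, ∀ i < j, p j ≤ p i
  summable : ∀ j > r, Summable fun m => p (m + (j + 1)) * a ^ (m + 1)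
  tail_le : ∀ j > r, ∀ i < j, ∑' m, p (m + (j + 1)) * a ^ (m + 1) ≤ p i

namespace LightTail

variable {p : ℕ → ℝ} {a b : ℝ} {r : ℕ} {n : ℕ → ℕ}

lemma lt_of_add_two_le (hL : LightTail p a r) (hp : ∀ i, 0 < p i) (ha : 1 < a) {i j : ℕ}
    (hij : i + 2 ≤ j) (hj : r + 2 ≤ j) : p j < p i := by
  obtain ⟨k, rfl⟩ : ∃ k, j = k + 1 := ⟨j - 1, by omega⟩
  have h1 := hL.tail_le k (by omega) i (by omega)
  have h2 := (hL.summable k (by omega)).le_tsum 0 (fun m _ => by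
    have := hp (m + (k + 1)); positivity)
  simp only [zero_add, pow_one] at h2
  have := hp (k + 1)
  nlinarith

/-- Below a symbol `i` before the tail there is not enough room for two copies of its node in the
tail: the tail could otherwise be packed into half of its nodes, at a cost lower than what
shortening `i` gains. -/
lemma tail_mass_lt (hL : LightTail p a r) (hp : ∀ i, 0 < p i) (hps : Summable p) (hb : 1 ≤ b)
    (hab : b < a) (h : IsOptLen p b n) {i j : ℕ} (hij : i < j) (hj : r < j) :
    ∑' t, (2⁻¹ : ℝ) ^ n (t + (j + 1)) < 2 * 2⁻¹ ^ n i := by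
  by_contra hge
  push Not at hge
  have hn := h.length_pos i
  have h1 := h.shorten_le_range (g := fun t => t + (j + 1)) (add_left_injective _) (i := i)
    (by intro t; omega) hge
  have hsa := hL.summable j hj
  have hs : Summable fun t => p (t + (j + 1)) * penalty b (n i - 1 + (t + 1)) := by
    refine Summable.of_nonneg_of_le (fun t => mul_nonneg (hp _).le (penalty_nonneg hb _))
      (fun t => mul_le_mul_of_nonneg_left 
        (penalty_le_pow_div (hb.trans_lt hab) hb hab.le _) (hp _).le) ?_
    refine (hsa.mul_left (a ^ (n i - 1) / (a - 1))).congr fun t => ?_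
    rw [pow_add]; ring
  obtain ⟨-, h2, h3⟩ := h.tail_le hb hps (m := j + 1) (l := n i - 1) kraftLE_succ (by
    refine le_trans (le_of_eq ?_) hge
    obtain ⟨m, hm⟩ : ∃ m, n i = m + 1 := ⟨n i - 1, by omega⟩
    rw [hm, pow_succ, Nat.add_sub_cancel]; ring) hs
  have hb0 : 0 < b ^ (n i - 1) := by positivity
  have h4 : ∑' t, p (t + (j + 1)) * b ^ (n i - 1 + (t + 1)) <
      ∑' t, b ^ (n i - 1) * (p (t + (j + 1)) * a ^ (t + 1)) := by
    refine Summable.tsum_lt_tsum (i := 0) (fun t => ?_) ?_ h2 (hsa.mul_left _)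
    · have := hp (t + (j + 1))
      have : b ^ (t + 1) ≤ a ^ (t + 1) := pow_le_pow_left₀ (by linarith) hab.le _
      rw [pow_add]
      calc _ = b ^ (n i - 1) * (p (t + (j + 1)) * b ^ (t + 1)) := by ring
        _ ≤ _ := by gcongr
    · have := hp (0 + (j + 1))
      simp only [pow_add, zero_add, pow_one]
      calc _ = b ^ (n i - 1) * (p (j + 1) * b) := by ring
        _ < _ := by gcongr; simpa using this
  rw [tsum_mul_left] at h4
  have h5 := hL.tail_le j hj i hij
  have := mul_le_mul_of_nonneg_left h5 hb0.le
  linarith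

end LightTail

/-- Lengths that exhaust Kraft's inequality, are largest at `j` among the first symbols, and whose
tails are lighter than two nodes, grow by one per symbol: the tail after `j` fills exactly one node
at depth `n(j)`. -/
lemma succ_of_tail_mass_lt {n : ℕ → ℕ} {R : ℕ} (hs : Summable fun i => (2⁻¹ : ℝ) ^ n i)
    (h1 : ∑' i, (2⁻¹ : ℝ) ^ n i = 1) (hmax : ∀ j ≥ R, ∀ i ≤ j, n i ≤ n j)
    (hT : ∀ j > R, ∑' t, (2⁻¹ : ℝ) ^ n (t + (j + 1)) < 2 * 2⁻¹ ^ n (j - 1)) :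
    ∀ j ≥ R + 1, n (j + 1) = n j + 1 := by
  set T : ℕ → ℝ := fun j => ∑' t, (2⁻¹ : ℝ) ^ n (t + (j + 1)) with hTdef
  have hrec : ∀ j, T j = 2⁻¹ ^ n (j + 1) + T (j + 1) := by
    intro j
    simp only [hTdef]
    rw [((summable_nat_add_iff (j + 1)).2 hs).tsum_eq_zero_add]
    simp only [zero_add]
    congr 2
    funext t
    congr 2
    omega
  have hpos : ∀ j, 0 < T j := fun j =>
    ((summable_nat_add_iff (j + 1)).2 hs).tsum_pos (fun _ => by positivity) 0 (by positivity)
  have hint : ∀ j ≥ R, ∃ I : ℕ, T j = I * 2⁻¹ ^ n j := by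
    intro j hj
    have h2 := hs.sum_add_tsum_nat_add (j + 1)
    rw [h1] at h2
    have h3 : ((∑ i ∈ Finset.range (j + 1), 2 ^ (n j - n i) : ℕ) : ℝ) =
        2 ^ n j * ∑ i ∈ Finset.range (j + 1), (2⁻¹ : ℝ) ^ n i := by
      rw [Finset.mul_sum]
      push_cast
      refine Finset.sum_congr rfl fun i hi => ?_
      rw [pow_sub₀ _ (by norm_num) (hmax j hj i (by simp at hi; omega)), inv_pow]
    have h4 : (2 : ℝ) ^ n j * T j =
        (2 ^ n j : ℕ) - (∑ i ∈ Finset.range (j + 1), 2 ^ (n j - n i) : ℕ) := by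
      rw [h3]
      have : T j = 1 - ∑ i ∈ Finset.range (j + 1), (2⁻¹ : ℝ) ^ n i := by simp only [hTdef]; linarith
      rw [this]
      push_cast
      linarith
    have h5 : (∑ i ∈ Finset.range (j + 1), 2 ^ (n j - n i) : ℕ) ≤ 2 ^ n j := by
      have : (0 : ℝ) < 2 ^ n j * T j := mul_pos (by positivity) (hpos j)
      rw [h4] at this
      have : ((∑ i ∈ Finset.range (j + 1), 2 ^ (n j - n i) : ℕ) : ℝ) < (2 ^ n j : ℕ) := by linarith
      exact_mod_cast this.le
    refine ⟨2 ^ n j - ∑ i ∈ Finset.range (j + 1), 2 ^ (n j - n i), ?_⟩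
    rw [Nat.cast_sub h5, ← h4, inv_pow]
    field_simp
  have hone : ∀ j ≥ R + 1, T j = 2⁻¹ ^ n j := by
    intro j hj
    have hx : (0 : ℝ) < 2⁻¹ ^ n j := by positivity
    obtain ⟨I, hI⟩ := hint j (by omega)
    have h2 : T (j + 1) < 2 * 2⁻¹ ^ n j := hT (j + 1) (by omega)
    have h3 : (2⁻¹ : ℝ) ^ n (j + 1) ≤ 2⁻¹ ^ n j :=
      pow_le_pow_of_le_one (by norm_num) (by norm_num) (hmax (j + 1) (by omega) j (by omega))
    have h4 := hrec j
    have h5 := hpos j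
    have hI3 : I < 3 := by
      have : (I : ℝ) < 3 := by nlinarith
      exact_mod_cast this
    have hI0 : 0 < I := by
      rcases Nat.eq_zero_or_pos I with rfl | h
      · simp at hI; linarith
      · exact h
    rcases (show I = 1 ∨ I = 2 by omega) with rfl | rfl
    · simpa using hI
    · -- The tail after `j - 1` would consist of three nodes at depth `n j`, but its mass is a
      -- multiple of `2^{-n(j-1)}`, an even number of such nodes.
      exfalso
      obtain ⟨k, rfl⟩ : ∃ k, j = k + 1 := ⟨j - 1, by omega⟩
      have h6 : T (k + 1) < 2 * 2⁻¹ ^ n k := hT (k + 1) (by omega)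
      have h7 : n k < n (k + 1) := by
        by_contra hle
        have : (2⁻¹ : ℝ) ^ n k ≤ 2⁻¹ ^ n (k + 1) :=
          pow_le_pow_of_le_one (by norm_num) (by norm_num) (by omega)
        rw [hI] at h6
        push_cast at h6
        linarith
      obtain ⟨I', hI'⟩ := hint k (by omega)
      obtain ⟨d, hd⟩ : ∃ d, n (k + 1) = n k + (d + 1) := ⟨n (k + 1) - n k - 1, by omega⟩
      rw [hrec k, hI, hd, pow_add] at hI'
      have hy : (0 : ℝ) < 2⁻¹ ^ n k := by positivity
      have h8 : (3 : ℝ) * 2⁻¹ ^ (d + 1) = I' := by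
        push_cast at hI'
        apply mul_left_cancel₀ hy.ne'
        linarith
      have h9 : (3 : ℝ) = I' * 2 ^ (d + 1) := by
        rw [← h8, mul_assoc, ← mul_pow]; norm_num
      have h10 : 3 = I' * 2 ^ (d + 1) := by exact_mod_cast h9
      rw [pow_succ, ← mul_assoc] at h10
      omega
  intro j hj
  have h2 := hrec j
  rw [hone j hj, hone (j + 1) (by omega)] at h2
  have h3 : (2⁻¹ : ℝ) ^ (n j + 1) = 2⁻¹ ^ n (j + 1) := by rw [pow_succ]; linarith
  exact (pow_right_injective₀ (by norm_num : (0 : ℝ) < 2⁻¹) (by norm_num) h3).symm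

lemma IsOptLen.comp_perm {p : ℕ → ℝ} {b : ℝ} {n : ℕ → ℕ} (h : IsOptLen p b n) (σ : Equiv.Perm ℕ)
    (hσ : ∀ i, p (σ i) = p i) : IsOptLen p b (n ∘ σ) := by
  have e : ∀ f : ℕ → ℝ, (fun i => p i * f (n (σ i))) = (fun i => p i * f (n i)) ∘ σ := by
    intro f; funext i; simp [hσ]
  refine ⟨⟨σ.summable_iff.2 h.kraft.1, ?_⟩, ?_, ?_, ?_⟩
  · exact (σ.tsum_eq fun i => (2⁻¹ : ℝ) ^ n i).trans_le h.kraft.2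
  · simp only [Function.comp_def]
    rw [e fun m => b ^ m]
    exact σ.summable_iff.2 h.summable_pow
  · simp only [Function.comp_def]
    rw [e (penalty b)]
    exact σ.summable_iff.2 h.summable_penalty
  · intro n' hn' hs
    refine le_trans (le_of_eq ?_) (h.le n' hn' hs)
    rw [← σ.tsum_eq fun i => p i * penalty b (n i)]
    simp [hσ]

/-- For a light-tailed source and `b < a` the optimal lengths are unary from some index on that
depends on the source only, after exchanging symbols of equal probability. Such ties occur only
between adjacent symbols, so that the exchange is an involution. -/
lemma LightTail.exists_perm_unary {p : ℕ → ℝ} {a b : ℝ} {r : ℕ} {n : ℕ → ℕ} (hL : LightTail p a r)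
    (hp : ∀ i, 0 < p i) (hps : Summable p) (hb : 1 ≤ b) (hab : b < a) (h : IsOptLen p b n) :
    ∃ σ : Equiv.Perm ℕ, (∀ i, p (σ i) = p i) ∧ IsOptLen p b (n ∘ σ) ∧
      ∀ j ≥ r + 4, n (σ (j + 1)) = n (σ j) + 1 := by
  classical
  have ha : 1 < a := by linarith
  have hlt : ∀ {i j : ℕ}, i + 2 ≤ j → r + 2 ≤ j → p j < p i := hL.lt_of_add_two_le hp ha
  -- the inversions; no two of them are adjacent
  let D : ℕ → Prop := fun j => r < j ∧ p j = p (j + 1) ∧ n (j + 1) < n j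
  have hD : ∀ j, D j → ¬ D (j + 1) := by
    rintro j ⟨h1, h2, -⟩ ⟨-, h3, -⟩
    have := hlt (i := j) (j := j + 2) (by omega) (by omega)
    rw [h2, h3] at this
    exact lt_irrefl _ this
  let s : ℕ → ℕ := fun j => if D j then j + 1 else if 1 ≤ j ∧ D (j - 1) then j - 1 else j
  have hs : Function.Involutive s := by
    intro j
    by_cases h1 : D j
    · have e1 : s j = j + 1 := by simp [s, h1]
      rw [e1]
      simp [s, h1, hD j h1]
    · by_cases h2 : 1 ≤ j ∧ D (j - 1)
      · have e1 : s j = j - 1 := by simp only [s, h1, h2]; simp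
        rw [e1]
        simp only [s, h2.2, if_true]
        omega
      · have e1 : s j = j := by simp only [s, h1, h2]; simp
        rw [e1, e1]
  let τ : Equiv.Perm ℕ := Function.Involutive.toPerm s hs
  have hσ : ∀ i, p (τ i) = p i := by
    intro j
    change p (s j) = p j
    by_cases h1 : D j
    · simp [s, h1, h1.2.1]
    · by_cases h2 : 1 ≤ j ∧ D (j - 1)
      · have e1 : s j = j - 1 := by simp only [s, h1, h2]; simp
        rw [e1, h2.2.2.1]
        congr 1
        omega
      · have e1 : s j = j := by simp only [s, h1, h2]; simp
        rw [e1]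
  have hopt := h.comp_perm τ hσ
  have hmax : ∀ j ≥ r + 3, ∀ i ≤ j, (n ∘ τ) i ≤ (n ∘ τ) j := by
    intro j hj i hij
    rcases hij.eq_or_lt with rfl | hij
    · exact le_rfl
    by_cases hpp : p j < p i
    · exact hopt.le_of_lt_prob hb (hp j) hpp
    have hi : ¬ (i + 2 ≤ j) := fun h' => hpp (hlt h' (by omega))
    obtain rfl : j = i + 1 := by omega
    have heq : p i = p (i + 1) :=
      le_antisymm (not_lt.1 hpp) (hL.antitone (i + 1) (by omega) i (by omega))
    change n (s i) ≤ n (s (i + 1))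
    by_cases h1 : D i
    · have e1 : s i = i + 1 := by simp [s, h1]
      have e2 : s (i + 1) = i := by rw [← e1]; exact hs i
      rw [e1, e2]
      exact h1.2.2.le
    · have h2 : ¬ D (i + 1) := by
        rintro ⟨-, h3, -⟩
        have := hlt (i := i) (j := i + 2) (by omega) (by omega)
        rw [heq, h3] at this
        exact lt_irrefl _ this
      have h3 : ¬ (1 ≤ i ∧ D (i - 1)) := by
        rintro ⟨h4, h5, h6, -⟩
        have := hlt (i := i - 1) (j := i + 1) (by omega) (by omega)
        rw [h6, Nat.sub_add_cancel h4, heq] at this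
        exact lt_irrefl _ this
      have e1 : s i = i := by simp only [s, h1, h3]; simp
      have e2 : s (i + 1) = i + 1 := by simp [s, h1, h2]
      rw [e1, e2]
      by_contra hlt'
      exact h1 ⟨by omega, heq, by omega⟩
  refine ⟨τ, hσ, hopt, ?_⟩
  refine succ_of_tail_mass_lt hopt.kraft.1 (hopt.kraft_eq_one hp (by linarith)) hmax ?_
  intro j hj
  exact hL.tail_mass_lt hp hps hb hab hopt (by omega) (by omega)

/-! ### Optimal lengths for geometric weights -/

open Filter Topology

/-- If `I(l) = o(2^l)` and each step of `I(l+1) = 2 I(l) - c(l+1)` has `c ≤ K`, then `I ≤ K`; and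
`I` stays at `K` once it is there. -/
lemma le_of_two_mul_sub_le {I : ℕ → ℤ} {K : ℤ} {l : ℕ}
    (hI : Tendsto (fun l => (I l : ℝ) * 2⁻¹ ^ l) atTop (𝓝 0))
    (hc : ∀ l' ≥ l, 2 * I l' - I (l' + 1) ≤ K) :
    I l ≤ K ∧ (I l = K → ∀ l' ≥ l, I l' = K) := by
  let x : ℕ → ℝ := fun l' => ((I l' : ℝ) - K) * 2⁻¹ ^ l'
  have hx : Tendsto x atTop (𝓝 0) := by
    have h1 := (tendsto_pow_atTop_nhds_zero_of_lt_one (r := (2⁻¹ : ℝ)) (by norm_num)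
      (by norm_num)).const_mul (K : ℝ)
    have := hI.sub h1
    simp only [mul_zero, sub_zero] at this
    refine this.congr fun l' => ?_
    simp only [x]; ring
  have hstep : ∀ l' ≥ l, x l' ≤ x (l' + 1) := by
    intro l' hl'
    have h1 : (2 : ℝ) * I l' - I (l' + 1) ≤ K := by exact_mod_cast hc l' hl'
    have h2 : (0 : ℝ) < 2⁻¹ ^ l' := by positivity
    simp only [x, pow_succ]
    nlinarith
  have hmono : ∀ l' ≥ l, ∀ t, x l' ≤ x (l' + t) := by
    intro l' hl' t
    induction t with
    | zero => exact le_rfl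
    | succ t ih => exact ih.trans (hstep (l' + t) (by omega))
  have hle : ∀ l' ≥ l, I l' ≤ K := by
    intro l' hl'
    have h1 : x l' ≤ 0 := ge_of_tendsto hx (by
      filter_upwards [eventually_ge_atTop l'] with t ht
      obtain ⟨s, rfl⟩ := Nat.exists_eq_add_of_le ht
      exact hmono l' hl' s)
    have h2 : (0 : ℝ) < 2⁻¹ ^ l' := by positivity
    have h3 : (I l' : ℝ) - K ≤ 0 := by
      by_contra h
      push Not at h
      exact absurd h1 (not_le.2 (mul_pos h h2))
    have : (I l' : ℝ) ≤ K := by linarith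
    exact_mod_cast this
  refine ⟨hle l le_rfl, fun h l' hl' => le_antisymm (hle l' hl') ?_⟩
  obtain ⟨s, rfl⟩ := Nat.exists_eq_add_of_le hl'
  have h1 := hmono l le_rfl s
  have h2 : (0 : ℝ) < 2⁻¹ ^ (l + s) := by positivity
  simp only [x, h, sub_self, zero_mul] at h1
  have h3 : (0 : ℝ) ≤ (I (l + s) : ℝ) - K := nonneg_of_mul_nonneg_left h1 h2
  have : (K : ℝ) ≤ I (l + s) := by linarith
  exact_mod_cast this

lemma ge_of_le_two_mul_sub {I : ℕ → ℤ} {K : ℤ} {l : ℕ}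
    (hI : Tendsto (fun l => (I l : ℝ) * 2⁻¹ ^ l) atTop (𝓝 0))
    (hc : ∀ l' ≥ l, K ≤ 2 * I l' - I (l' + 1)) :
    K ≤ I l ∧ (I l = K → ∀ l' ≥ l, I l' = K) := by
  have := le_of_two_mul_sub_le (I := fun l => -I l) (K := -K) (l := l)
    (by simpa using hI.neg) (fun l' hl' => by have := hc l' hl'; linarith)
  simpa using this

lemma tsum_indicator_pair {x y : ℕ} (h : x ≠ y) (f : ℕ → ℝ) :
    ∑' z, ({x, y} : Set ℕ).indicator f z = f x + f y := by
  rw [tsum_eq_sum (s := {x, y}) (by intro z hz; simp at hz; simp [hz]), Finset.sum_pair h]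
  simp

lemma tsum_half_pow_add (m : ℕ) : ∑' t : ℕ, (2⁻¹ : ℝ) ^ (m + t) = 2 * 2⁻¹ ^ m := by
  simp only [pow_add, tsum_mul_left]
  rw [tsum_geometric_of_lt_one (by norm_num) (by norm_num)]
  ring

/-- Weights in geometric progression with ratio `θ`. -/
structure IsGeomWeight (p : ℕ → ℝ) (θ : ℝ) : Prop where
  theta_pos : 0 < θ
  theta_lt_one : θ < 1
  pos : ∀ i, 0 < p i
  add : ∀ i t, p (i + t) = p i * θ ^ t

namespace IsGeomWeight

variable {p : ℕ → ℝ} {θ b : ℝ} {n : ℕ → ℕ} {k : ℕ}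

lemma monotone (hg : IsGeomWeight p θ) (hb : 1 ≤ b) (h : IsOptLen p b n) : Monotone n := by
  refine monotone_nat_of_le_succ fun i => h.le_of_lt_prob hb (hg.pos _) ?_
  rw [hg.add, pow_one]
  have := hg.pos i
  have := hg.theta_lt_one
  nlinarith

/-- At most `k + 1` codewords have the same length: otherwise the first of them could be exchanged
with the parent of two others. -/
lemma lt_add_succ (hg : IsGeomWeight p θ) (hb : 1 ≤ b) (h : IsOptLen p b n) (hk : 1 ≤ k)
    (hkb : θ ^ k * b * (1 + θ) < 1) (i : ℕ) : n i < n (i + k + 1) := by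
  by_contra hle
  have hm := hg.monotone hb h
  have h1 : n (i + k) = n i := le_antisymm ((hm (by omega)).trans (not_lt.1 hle)) (hm (by omega))
  have h2 : n (i + k + 1) = n i := le_antisymm (not_lt.1 hle) (hm (by omega))
  have h3 := h.shorten_le (S := {i + k, i + k + 1}) (i := i) (by simp; omega) (by
    rw [tsum_indicator_pair (by omega) fun x => (2⁻¹ : ℝ) ^ n x, h1, h2]
    linarith [h.kraft.2])
  rw [tsum_indicator_pair (by omega) fun x => p x * b ^ n x, h1, h2, add_assoc,
    hg.add, hg.add] at h3
  obtain ⟨d, hd⟩ : ∃ d, n i = d + 1 := ⟨n i - 1, by have := h.length_pos i; omega⟩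
  rw [hd] at h3
  simp only [Nat.add_sub_cancel, pow_succ] at h3
  have h4 : 0 < p i * b ^ d := mul_pos (hg.pos i) (by positivity)
  have h5 := mul_lt_mul_of_pos_left hkb h4
  nlinarith

/-- If `i + k` and `i + k + 1` have the same length, then it exceeds that of `i` by at most one:
otherwise `i` could be exchanged with the parent of these two. -/
lemma le_succ_of_eq (hg : IsGeomWeight p θ) (hb : 1 ≤ b) (h : IsOptLen p b n)
    (hkb : 1 < θ ^ k * b * (1 + θ)) {i : ℕ} (he : n (i + k) = n (i + k + 1)) :
    n (i + k) ≤ n i + 1 := by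
  by_contra hlt
  push Not at hlt
  have hk : k ≠ 0 := by rintro rfl; simp at hlt
  obtain ⟨d, hd⟩ : ∃ d, n (i + k) = n i + 2 + d := ⟨n (i + k) - n i - 2, by omega⟩
  have hb0 : 0 < b := by linarith
  have h3 := h.le_lengthen (S := {i + k, i + k + 1}) (i := i) (by simp [hk]; omega) (by
    rw [tsum_indicator_pair (by omega) fun x => (2⁻¹ : ℝ) ^ n x, ← he, hd]
    have : (2⁻¹ : ℝ) ^ d ≤ 1 := pow_le_one₀ (by norm_num) (by norm_num)
    have h' : (0 : ℝ) < 2⁻¹ ^ n i := by positivity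
    rw [pow_add, pow_add]
    nlinarith) hb0.ne'
  rw [tsum_indicator_pair (by omega) fun x => p x * b ^ n x, ← he, hd, div_le_iff₀ hb0,
    show p (i + k + 1) = p i * θ ^ (k + 1) by rw [add_assoc, hg.add], hg.add] at h3
  have h4 : 0 < p i * b ^ n i * b := mul_pos (mul_pos (hg.pos i) (by positivity)) hb0
  have h5 := mul_lt_mul_of_pos_left hkb h4
  have h6 : (1 : ℝ) ≤ b ^ d := one_le_pow₀ hb
  have h7 : p i * θ ^ k * b ^ (n i + 2 + d) + p i * θ ^ (k + 1) * b ^ (n i + 2 + d)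
      = p i * b ^ n i * b * (θ ^ k * b * (1 + θ)) * b ^ d := by ring
  rw [h7] at h3
  have h8 : 0 < p i * b ^ n i * b * (θ ^ k * b * (1 + θ)) := by linarith
  nlinarith

/-- The lengths cannot run with period `k + 1`, since `i` could be exchanged with the parent of
the chain of symbols `i + k, i + k + (k + 1), …`. -/
lemma not_period_succ (hg : IsGeomWeight p θ) (hb : 1 ≤ b) (h : IsOptLen p b n) (hk : 1 ≤ k)
    (hkb : θ ^ k * b * (1 + θ) < 1) (i : ℕ) (hper : ∀ t, n (i + (k + t * (k + 1))) = n i + t) :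
    False := by
  have hθ := hg.theta_pos
  have h1 := h.shorten_le_range (g := fun t => i + (k + t * (k + 1))) (i := i)
    (fun s t hst => by simpa using hst) (by intro t; simp only [ne_eq]; omega) (by
      simp only [hper]
      rw [tsum_half_pow_add])
  have hr0 : 0 ≤ θ ^ (k + 1) * b := by positivity
  have hr1 : θ ^ (k + 1) * b < 1 := by
    have : 0 ≤ θ ^ k * b := by positivity
    rw [pow_succ]; nlinarith
  have h2 : ∀ t : ℕ, p (i + (k + t * (k + 1))) * b ^ n (i + (k + t * (k + 1))) =
      p i * θ ^ k * b ^ n i * (θ ^ (k + 1) * b) ^ t := by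
    intro t
    rw [hper, hg.add, mul_pow, ← pow_mul, pow_add, pow_add, mul_comm t]; ring
  simp only [h2, tsum_mul_left, tsum_geometric_of_lt_one hr0 hr1] at h1
  obtain ⟨d, hd⟩ : ∃ d, n i = d + 1 := ⟨n i - 1, by have := h.length_pos i; omega⟩
  rw [hd, Nat.add_sub_cancel, ← div_eq_mul_inv, le_div_iff₀ (by linarith)] at h1
  have h4 : 0 < p i * b ^ d := mul_pos (hg.pos i) (by positivity)
  have h5 : p i * b ^ d * (1 - θ ^ (k + 1) * b) ≤ p i * b ^ d * (θ ^ k * b) := by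
    refine h1.trans (le_of_eq ?_); ring
  have h6 := le_of_mul_le_mul_left h5 h4
  rw [pow_succ] at h6
  nlinarith

/-- The lengths cannot run with a period `k` that is too short, since `i` could be exchanged with
the parent of the chain of symbols `i + 1 + k, i + 1 + 2 k, …`. -/
lemma not_period (hg : IsGeomWeight p θ) (hb : 1 ≤ b) (h : IsOptLen p b n) (hk : 1 ≤ k)
    (hkb : 1 < θ ^ k * b * (1 + θ)) (i : ℕ)
    (hper : ∀ t, n (i + (1 + k * (t + 1))) = n i + (2 + t)) : False := by
  have hθ := hg.theta_pos
  have hb0 : 0 < b := by linarith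
  have hinj : Function.Injective fun t => i + (1 + k * (t + 1)) := fun s t hst => by
    have : k ≠ 0 := by omega
    simpa [this] using hst
  have h1 := h.le_lengthen_range (g := fun t => i + (1 + k * (t + 1))) (i := i)
    hinj (by intro t; simp only [ne_eq]; omega) (by
      simp only [hper]
      simp only [← add_assoc]
      rw [tsum_half_pow_add, pow_add]
      apply le_of_eq; ring) hb0.ne'
  have h2 : ∀ t : ℕ, p (i + (1 + k * (t + 1))) * b ^ n (i + (1 + k * (t + 1))) =
      p i * θ ^ (k + 1) * b ^ (n i + 2) * (θ ^ k * b) ^ t := by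
    intro t
    rw [hper, hg.add, mul_pow, ← pow_mul]; ring
  have hs := h.summable_pow.comp_injective hinj
  simp only [Function.comp_def, h2] at hs
  have hp := hg.pos i
  rw [summable_mul_left_iff (by positivity), summable_geometric_iff_norm_lt_one,
    Real.norm_of_nonneg (by positivity)] at hs
  simp only [h2, tsum_mul_left, tsum_geometric_of_lt_one (by positivity : 0 ≤ θ ^ k * b) hs] at h1
  rw [div_le_iff₀ hb0, ← div_eq_mul_inv, div_le_iff₀ (by linarith)] at h1
  have h4 : 0 < p i * b ^ n i * b := by positivity
  have h5 : p i * b ^ n i * b * (θ ^ (k + 1) * b) ≤ p i * b ^ n i * b * (1 - θ ^ k * b) := by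
    refine le_trans (le_of_eq ?_) h1; ring
  have h6 := le_of_mul_le_mul_left h5 h4
  rw [pow_succ] at h6
  nlinarith

/-- The structure found by Gallager and Van Voorhis: if `θ^{k+1} b (1 + θ) < 1 < θ^k b (1 + θ)`,
then optimal lengths eventually run with period `k + 1`. In terms of the number `I(l)` of internal
nodes at depth `l`, the pair exchanges bound the number of leaves per level from above and below,
which forces `I(l) = k + 1` or a wrong constant period, and the chain exchanges exclude the latter.
-/
lemma add_period (hg : IsGeomWeight p θ) (hb : 1 ≤ b) (h : IsOptLen p b n)
    (hk1 : θ ^ (k + 1) * b * (1 + θ) < 1) (hk2 : 1 < θ ^ k * b * (1 + θ)) {i : ℕ}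
    (hi : 2 * k + 3 ≤ i) : n (i + (k + 1)) = n i + 1 := by
  classical
  have hmono := hg.monotone hb h
  have hex : ∀ l, ∃ i, l < n i := by
    intro l
    by_contra hcon
    push Not at hcon
    exact Set.infinite_univ ((h.kraft.finite_le l).subset fun i _ => hcon i)
  -- `m l` symbols have length at most `l`
  let m : ℕ → ℕ := fun l => Nat.find (hex l)
  have hm : ∀ l i, i < m l ↔ n i ≤ l := by
    intro l i
    constructor
    · intro hi
      exact not_lt.1 (Nat.find_min (hex l) hi)
    · intro hi
      by_contra hle
      have := hmono (not_lt.1 hle)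
      have := Nat.find_spec (hex l)
      simp only [m] at *
      omega
  have hm' : ∀ l i, m l ≤ i ↔ l < n i := fun l i => by rw [← not_lt, hm, not_le]
  have hmm : Monotone m := fun l l' hl => by
    by_contra hlt
    push Not at hlt
    have := (hm l (m l')).1 hlt
    have := (hm' l' (m l')).1 le_rfl
    omega
  -- the number of internal nodes at depth `l`
  obtain ⟨I, hIzero, hI⟩ : ∃ I : ℕ → ℤ, I 0 = 1 ∧
      ∀ l, I (l + 1) = 2 * I l - ((m (l + 1) : ℤ) - m l) :=
    ⟨fun l => Nat.rec (motive := fun _ => ℤ) 1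
      (fun l x => 2 * x - ((m (l + 1) : ℤ) - m l)) l, rfl, fun _ => rfl⟩
  have hsum : ∀ l, ∑ i ∈ Finset.range (m l), (2⁻¹ : ℝ) ^ n i = 1 - (I l : ℝ) * 2⁻¹ ^ l := by
    intro l
    induction l with
    | zero =>
      have : m 0 = 0 := by
        by_contra h0
        have h1 := (hm 0 0).1 (Nat.pos_of_ne_zero h0)
        have := h.length_pos 0
        omega
      simp [this, hIzero]
    | succ l ih =>
      rw [← Finset.sum_range_add_sum_Ico _ (hmm (Nat.le_succ l)), ih]
      have : ∑ i ∈ Finset.Ico (m l) (m (l + 1)), (2⁻¹ : ℝ) ^ n i =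
          ((m (l + 1) : ℝ) - m l) * 2⁻¹ ^ (l + 1) := by
        rw [Finset.sum_congr rfl (g := fun _ => (2⁻¹ : ℝ) ^ (l + 1))]
        · rw [Finset.sum_const, Nat.card_Ico, nsmul_eq_mul, Nat.cast_sub (hmm (Nat.le_succ l))]
        · intro x hx
          rw [Finset.mem_Ico] at hx
          have h1 := (hm' l x).1 hx.1
          have h2 := (hm (l + 1) x).1 hx.2
          rw [show n x = l + 1 by omega]
      rw [this, hI, pow_succ]
      push_cast
      ring
  have hmtop : Tendsto m atTop atTop := tendsto_atTop_atTop.2 fun i =>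
    ⟨n i, fun l hl => ((hm l i).2 hl).le⟩
  have hI0 : Tendsto (fun l => (I l : ℝ) * 2⁻¹ ^ l) atTop (𝓝 0) := by
    have h1 := h.kraft.1.hasSum.tendsto_sum_nat.comp hmtop
    rw [h.kraft_eq_one hg.pos (by linarith)] at h1
    have h2 := h1.const_sub 1
    simp only [Function.comp_def, hsum, sub_sub_cancel, sub_self] at h2
    exact h2
  have hIpos : ∀ l, 0 < I l := by
    intro l
    have h1 := h.kraft.sum_le (Finset.range (m l + 1))
    rw [Finset.sum_range_succ, hsum] at h1
    have h2 : (0 : ℝ) < 2⁻¹ ^ n (m l) := by positivity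
    have h3 : (0 : ℝ) < (I l : ℝ) * 2⁻¹ ^ l := by linarith
    have h4 : (0 : ℝ) < I l := pos_of_mul_pos_left h3 (by positivity)
    exact_mod_cast h4
  have hc0 : ∀ l, 0 ≤ 2 * I l - I (l + 1) := by
    intro l
    have := hmm (Nat.le_succ l)
    rw [hI]; push_cast [Nat.succ_eq_add_one] at this ⊢; omega
  -- where `I` has the constant value `K`, each level has `K` leaves
  have hlevel : ∀ K : ℕ, ∀ l, (∀ l' ≥ l, I l' = K) → ∀ q < K, ∀ t,
      n (m l + q + K * t) = l + t + 1 := by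
    intro K l hconst q hq t
    have hml : ∀ t, m (l + t) = m l + K * t := by
      intro t
      induction t with
      | zero => simp
      | succ t ih =>
        have h1 := hI (l + t)
        rw [hconst _ (by omega), hconst _ (by omega)] at h1
        have : (m (l + t + 1) : ℤ) = m (l + t) + K := by linarith
        have : m (l + t + 1) = m (l + t) + K := by exact_mod_cast this
        rw [← add_assoc, this, ih]; ring
    have h1 : l + t < n (m l + q + K * t) := (hm' _ _).1 (by rw [hml]; omega)
    have h2 : n (m l + q + K * t) ≤ l + t + 1 := (hm _ _).1 (by
      rw [add_assoc l t 1, hml, mul_add]; omega)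
    omega
  -- a level has at most `k + 2` leaves
  have hub : ∀ l, 2 * I l - I (l + 1) ≤ ((k + 2 : ℕ) : ℤ) := by
    intro l
    rw [hI]
    by_contra hlt
    have h1 : m l + (k + 1) + 1 < m (l + 1) := by push_cast at hlt; omega
    have h2 := (hm (l + 1) _).1 h1
    have h3 := (hm' l (m l)).1 le_rfl
    have h4 := hg.lt_add_succ hb h (by omega) hk1 (m l)
    omega
  have hIle : ∀ l, I l ≤ k + 1 := by
    intro l
    obtain ⟨h1, h2⟩ := le_of_two_mul_sub_le (l := l) hI0 fun l' _ => hub l'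
    by_contra hlt
    have h3 := hlevel _ l (h2 (by push_cast at h1 ⊢; omega))
    refine hg.not_period_succ hb h (by omega) hk1 (m l) fun t => ?_
    have h4 := h3 (k + 1) (by omega) t
    have h5 := h3 0 (by omega) 0
    simp only [mul_zero, add_zero] at h5
    rw [h5, show m l + (k + 1 + t * (k + 1 + 1)) = m l + (k + 1) + (k + 2) * t by ring, h4]
    ring
  -- the tail is not the Golomb code of a period `K ≤ k`
  have hlow : ∀ K : ℕ, 1 ≤ K → K ≤ k → ∀ l, ¬ ∀ l' ≥ l, I l' = K := by
    intro K hK1 hKk l hconst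
    have h3 := hlevel K l hconst
    have hK : 1 < θ ^ K * b * (1 + θ) := by
      refine hk2.trans_le ?_
      have h4 := pow_le_pow_of_le_one hg.theta_pos.le hg.theta_lt_one.le hKk
      have := hg.theta_pos
      gcongr
    refine hg.not_period hb h hK1 hK (m l + (K - 1)) fun t => ?_
    have h4 := h3 (K - 1) (by omega) 0
    simp only [mul_zero, add_zero] at h4
    rw [h4, show m l + (K - 1) + (1 + K * (t + 1)) = m l + 0 + K * (t + 2) by
      rw [mul_add, mul_add]; omega, h3 0 (by omega)]
    ring
  -- two leaves on a level force at least `k` leaves on the level above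
  have hB : ∀ l, k + 1 ≤ m (l + 1) → 2 ≤ 2 * I (l + 1) - I (l + 2) →
      (k : ℤ) ≤ 2 * I l - I (l + 1) := by
    intro l hml hc
    rw [hI (l + 1)] at hc
    have h1 := (hm' (l + 1) (m (l + 1))).1 le_rfl
    have h2 := (hm (l + 2) (m (l + 1) + 1)).1 (by
      have : l + 1 + 1 = l + 2 := rfl
      rw [this] at hc; omega)
    have h3 := hmono (Nat.le_succ (m (l + 1)))
    obtain ⟨x, hx⟩ : ∃ x, m (l + 1) = x + k := ⟨m (l + 1) - k, by omega⟩
    rw [hx] at h1 h2 h3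
    have h4 := hg.le_succ_of_eq hb h hk2 (i := x) (by simp only [Nat.succ_eq_add_one] at h3; omega)
    have h5 := (hm' l x).2 (by omega)
    rw [hI l, hx]
    push_cast
    omega
  have hIk : ∀ l, k + 1 ≤ m l → I l = k + 1 := by
    intro l hml
    refine le_antisymm (hIle l) ?_
    by_contra hlt
    by_cases hall : ∀ l' ≥ l, (k : ℤ) ≤ 2 * I l' - I (l' + 1)
    · obtain ⟨h1, h2⟩ := ge_of_le_two_mul_sub hI0 hall
      have h3 : I l = k := by omega
      have := hIpos l
      exact hlow k (by omega) le_rfl l (h2 h3)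
    push Not at hall
    obtain ⟨l₁, hl₁, hc⟩ := hall
    have hmge : ∀ l' ≥ l₁, k + 1 ≤ m (l' + 1) := fun l' hl' => hml.trans (hmm (by omega))
    have hnext : ∀ l' ≥ l₁, 2 * I l' - I (l' + 1) < k → 2 * I (l' + 1) - I (l' + 2) ≤ 1 := by
      intro l' hl' hc'
      by_contra hc2
      have := hB l' (hmge l' hl') (by omega)
      omega
    have h1 := hc0 l₁
    have h2 := hnext l₁ le_rfl hc
    by_cases hk : 2 ≤ k
    · have hone : ∀ l' ≥ l₁ + 1, 2 * I l' - I (l' + 1) ≤ ((1 : ℕ) : ℤ) := by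
        intro l' hl'
        induction l', hl' using Nat.le_induction with
        | base => exact h2
        | succ l' hl' ih => exact hnext l' (by omega) (by push_cast at ih; omega)
      obtain ⟨h3, h4⟩ := le_of_two_mul_sub_le hI0 hone
      have := hIpos (l₁ + 1)
      exact hlow 1 le_rfl (by omega) (l₁ + 1) (h4 (by push_cast at h3 ⊢; omega))
    · have h3 := hIpos l₁
      have h4 := hIle (l₁ + 2)
      omega
  -- the period from the level of symbol `k` on
  have hper : ∀ l, k + 1 ≤ m l → m (l + 1) = m l + (k + 1) := by
    intro l hl
    have h1 := hI l
    rw [hIk l hl, hIk (l + 1) (hl.trans (hmm (Nat.le_succ l)))] at h1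
    omega
  have h1 : n k < n i := lt_of_lt_of_le (by
    have := hg.lt_add_succ hb h (by omega) hk1 k
    exact this) (hmono (by omega))
  obtain ⟨l, hl⟩ : ∃ l, n i = l + 1 := ⟨n i - 1, by omega⟩
  have h2 : k + 1 ≤ m l := (hm l k).2 (by omega)
  have h3 := hper l h2
  have h4 := hper (l + 1) (by omega)
  have h5 := (hm' l i).2 (by omega)
  have h6 := (hm (l + 1) i).2 (by omega)
  have h7 := (hm' (l + 1) (i + (k + 1))).1 (by omega)
  have h8 := (hm (l + 1 + 1) (i + (k + 1))).1 (by omega)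
  omega

end IsGeomWeight

/-- For geometric weights an optimal code still has finite cost for a slightly larger base. The
symbols from `m` on cost at most a constant multiple of what `m` costs, since a fixed code could be
used for them below the node of `m`; so their cost decays geometrically, and the same comparison
bounds the increments of the lengths. -/
lemma IsGeomWeight.exists_gt_summable {p : ℕ → ℝ} {θ b : ℝ} {n g : ℕ → ℕ} (hg : IsGeomWeight p θ)
    (hb : 1 ≤ b) (hps : Summable p) (h : IsOptLen p b n) (hgK : KraftLE g)
    (hgs : Summable fun j => θ ^ j * penalty b (g j)) :
    ∃ b' > b, Summable fun i => p i * b' ^ n i := by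
  have hθ := hg.theta_pos
  have hb0 : 0 < b := by linarith
  have hmono := hg.monotone hb h
  have hgeo : Summable fun j : ℕ => θ ^ j := summable_geometric_of_lt_one hθ.le hg.theta_lt_one
  have hgp : Summable fun j => θ ^ j * b ^ g j := by
    refine (hgeo.add (hgs.mul_left (b - 1))).congr fun j => ?_
    rw [pow_eq_penalty b (g j)]; ring
  set C := ∑' j, θ ^ j * b ^ g j with hC
  set C₂ := ∑' j, θ ^ j * penalty b (g j) with hC₂
  have hCpos : 0 < C := hgp.tsum_pos (fun j => by positivity) 0 (by positivity)
  have hrepl : ∀ m, HasSum (fun j => p (j + m) * penalty b (n m + g j))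
      (p m * penalty b (n m) * (∑' j : ℕ, θ ^ j) + p m * b ^ n m * C₂) := by
    intro m
    refine ((hgeo.hasSum.mul_left _).add (hgs.hasSum.mul_left _)).congr_fun ?_
    intro j
    rw [penalty_add, add_comm j m, hg.add]; ring
  have hmass : ∀ m, (2⁻¹ : ℝ) ^ n m ≤ ∑' j, (2⁻¹ : ℝ) ^ n (j + m) := fun m => by
    have := ((summable_nat_add_iff m).2 h.kraft.1).le_tsum 0 (fun _ _ => by positivity)
    simpa using this
  have htail := fun m => h.tail_le hb hps hgK (hmass m) (hrepl m).summable
  set t : ℕ → ℝ := fun m => p m * b ^ n m with ht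
  set R : ℕ → ℝ := fun m => ∑' j, t (j + m) with hR
  have htpos : ∀ m, 0 < t m := fun m => mul_pos (hg.pos m) (by positivity)
  have hts : ∀ m, Summable fun j => t (j + m) := fun m =>
    (summable_nat_add_iff m).2 h.summable_pow
  have hRt : ∀ m, R m ≤ C * t m := by
    intro m
    refine (htail m).2.2.trans (le_of_eq ?_)
    rw [hC, ht, ← tsum_mul_right]
    refine tsum_congr fun j => ?_
    rw [add_comm j m, hg.add, pow_add]; ring
  have hRrec : ∀ m, R m = t m + R (m + 1) := by
    intro m
    simp only [hR]
    rw [(hts m).tsum_eq_zero_add]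
    simp only [zero_add]
    congr 2
    funext j
    congr 1
    omega
  have hRpos : ∀ m, 0 ≤ R m := fun m => tsum_nonneg fun j => (htpos _).le
  obtain ⟨ρ, hρ0, hρ1, hρ⟩ : ∃ ρ : ℝ, 0 < ρ ∧ ρ < 1 ∧ ∀ m, R (m + 1) ≤ ρ * R m := by
    refine ⟨max (1 - 1 / C) (1 / 2), by positivity, max_lt ?_ (by norm_num), fun m => ?_⟩
    · have : 0 < 1 / C := by positivity
      linarith
    · refine le_trans ?_ (mul_le_mul_of_nonneg_right (le_max_left _ _) (hRpos m))
      have h1 := hRt m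
      have h2 := hRrec m
      have h3 : R m / C ≤ t m := by rw [div_le_iff₀ hCpos]; linarith
      have : (1 - 1 / C) * R m = R m - R m / C := by ring
      linarith
  have hRgeo : ∀ m, R m ≤ ρ ^ m * R 0 := by
    intro m
    induction m with
    | zero => simp
    | succ m ih =>
      rw [pow_succ]
      have := mul_le_mul_of_nonneg_left ih hρ0.le
      linarith [hρ m]
  obtain ⟨D, hD⟩ : ∃ D : ℕ, ∀ m, n (m + 1) ≤ n m + D := by
    refine ⟨⌈C₂ / θ⌉₊, fun m => ?_⟩
    have hp := hg.pos m
    have h1 := (htail m).1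
    rw [(hrepl m).tsum_eq] at h1
    have h2 : HasSum (fun j : ℕ => p m * penalty b (n m) * θ ^ j +
        if j = 1 then p m * b ^ n m * (θ * ((n (m + 1) : ℝ) - n m)) else 0)
        (p m * penalty b (n m) * (∑' j : ℕ, θ ^ j) +
          p m * b ^ n m * (θ * ((n (m + 1) : ℝ) - n m))) :=
      (hgeo.hasSum.mul_left _).add (hasSum_ite_eq 1 _)
    have h3 := hasSum_le (fun j => ?_) h2 ((summable_nat_add_iff m).2 h.summable_penalty).hasSum
    · have h4 : p m * b ^ n m * (θ * ((n (m + 1) : ℝ) - n m)) ≤ p m * b ^ n m * C₂ := by linarith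
      have h5 := le_of_mul_le_mul_left h4 (htpos m)
      have h6 : (n (m + 1) : ℝ) - n m ≤ C₂ / θ := by rw [le_div_iff₀ hθ]; linarith
      have h7 := Nat.le_ceil (C₂ / θ)
      have : (n (m + 1) : ℝ) ≤ ((n m + ⌈C₂ / θ⌉₊ : ℕ) : ℝ) := by push_cast; linarith
      exact_mod_cast this
    · rw [add_comm j m, hg.add]
      split_ifs with hj
      · subst hj
        obtain ⟨d, hd⟩ := Nat.exists_eq_add_of_le (hmono (Nat.le_succ m))
        simp only [Nat.succ_eq_add_one] at hd
        rw [hd, penalty_add]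
        have := cast_le_penalty hb d
        push_cast
        have h' : p m * b ^ n m * θ * d ≤ p m * b ^ n m * θ * penalty b d := by gcongr
        rw [pow_one]
        linarith
      · have := penalty_mono hb (hmono (Nat.le_add_right m j))
        have h' : p m * θ ^ j * penalty b (n m) ≤ p m * θ ^ j * penalty b (n (m + j)) := by gcongr
        linarith
  have hlin : ∀ m, n m ≤ n 0 + D * m := by
    intro m
    induction m with
    | zero => simp
    | succ m ih =>
      have := hD m
      rw [mul_add]; omega
  obtain ⟨x, hx, hx1⟩ : ∃ x : ℝ, ρ * x ^ D < 1 ∧ 1 < x := by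
    have hcont : Tendsto (fun x : ℝ => ρ * x ^ D) (𝓝[>] 1) (𝓝 (ρ * 1 ^ D)) :=
      Tendsto.mono_left (Continuous.tendsto (by fun_prop) 1) nhdsWithin_le_nhds
    have h1 := hcont.eventually (gt_mem_nhds (by simpa using hρ1 : ρ * 1 ^ D < 1))
    exact (h1.and self_mem_nhdsWithin).exists
  refine ⟨b * x, by nlinarith, ?_⟩
  have hx0 : 0 < x := by linarith
  refine Summable.of_nonneg_of_le (fun m => mul_nonneg (hg.pos m).le (by positivity)) (fun m => ?_)
    ((summable_geometric_of_lt_one (by positivity) hx).mul_left (R 0 * x ^ n 0))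
  have h1 : t m ≤ ρ ^ m * R 0 := by
    have := hRrec m
    have := hRpos (m + 1)
    linarith [hRgeo m]
  have h2 : x ^ n m ≤ x ^ (n 0 + D * m) := pow_le_pow_right₀ hx1.le (hlin m)
  calc p m * (b * x) ^ n m = t m * x ^ n m := by rw [mul_pow, ht]; ring
    _ ≤ (ρ ^ m * R 0) * x ^ (n 0 + D * m) :=
        mul_le_mul h1 h2 (by positivity) (mul_nonneg (by positivity) (hRpos 0))
    _ = R 0 * x ^ n 0 * (ρ * x ^ D) ^ m := by rw [pow_add, mul_pow, ← pow_mul]; ring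

/-- Only finitely many length functions are bounded by `B` on an initial segment and eventually
run with a given period. -/
lemma finite_setOf_eventually_period {M k : ℕ} (B : ℕ) (hk : 1 ≤ k) (hkM : k ≤ M) :
    {n : ℕ → ℕ | (∀ i < M, n i ≤ B) ∧ ∀ i, M ≤ i + k → n (i + k) = n i + 1}.Finite := by
  refine Set.Finite.of_injOn (f := fun n (i : Fin M) => n i)
    (t := Set.pi Set.univ fun _ => Set.Iic B) ?_ ?_ (Set.Finite.pi fun _ => Set.finite_Iic B)
  · rintro n ⟨h1, -⟩ i -
    exact h1 i i.2
  · rintro n ⟨-, h1⟩ n' ⟨-, h2⟩ heq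
    funext i
    induction i using Nat.strong_induction_on with
    | _ i ih =>
      by_cases hi : i < M
      · exact congrFun heq ⟨i, hi⟩
      · obtain ⟨j, rfl⟩ : ∃ j, i = j + k := ⟨i - k, by omega⟩
        rw [h1 j (by omega), h2 j (by omega), ih j (by omega)]

/-! ### The overflow function and the stopping rule -/

open ProbabilityTheory

section Overflow

variable {p : PMF ℕ} {ν : Measure ℝ} [IsProbabilityMeasure ν] {C C' : PrefixCode} {s s' : ℝ}

/-- The net backlog `n(X) - T` produced by one source symbol `X`, on the product space of the
symbol and the intermission time. -/
def backlog (C : PrefixCode) (x : ℕ × ℝ) : ℝ := C.len x.1 - x.2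

lemma measurable_len (C : PrefixCode) : Measurable fun x : ℕ × ℝ => (C.len x.1 : ℝ) :=
  (measurable_of_countable fun i : ℕ => (C.len i : ℝ)).comp measurable_fst

lemma measurable_backlog (C : PrefixCode) : Measurable (backlog C) :=
  (measurable_len C).sub measurable_snd

lemma expSum_eq_lintegral (p : PMF ℕ) (C : PrefixCode) (s : ℝ) :
    expSum p C s = ∫⁻ i, ENNReal.ofReal (Real.exp (s * C.len i)) ∂p.toMeasure := by
  rw [lintegral_countable', expSum]
  refine tsum_congr fun i => ?_
  rw [PMF.toMeasure_apply_singleton _ _ (measurableSet_singleton i), mul_comm]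

lemma overflowFn_eq_lintegral (p : PMF ℕ) (ν : Measure ℝ) [IsProbabilityMeasure ν] (C : PrefixCode)
    (s : ℝ) : overflowFn p ν C s =
      ∫⁻ x, ENNReal.ofReal (Real.exp (s * backlog C x)) ∂(p.toMeasure.prod ν) := by
  rw [overflowFn, laplaceStieltjes, expSum_eq_lintegral, mul_comm, ← lintegral_prod_mul]
  · refine lintegral_congr fun x => ?_
    rw [← ENNReal.ofReal_mul (Real.exp_nonneg _), ← Real.exp_add, backlog]
    congr 2; ring
  · exact (measurable_of_countable _).aemeasurable
  · fun_prop

lemma overflowFn_zero : overflowFn p ν C 0 = 1 := by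
  simp [overflowFn_eq_lintegral]

lemma zero_mem_feasible : (0 : ℝ) ∈ feasible p ν C := overflowFn_zero.le

/-- By Fatou's lemma. -/
lemma isClosed_feasible : IsClosed (feasible p ν C) := by
  refine IsSeqClosed.isClosed fun u s hu hs => ?_
  change overflowFn p ν C s ≤ 1
  have h1 : ∀ x, liminf (fun k => ENNReal.ofReal (Real.exp (u k * backlog C x))) atTop =
      ENNReal.ofReal (Real.exp (s * backlog C x)) := fun x =>
    Tendsto.liminf_eq (((ENNReal.continuous_ofReal.comp
      (Real.continuous_exp.comp (continuous_id.mul continuous_const))).tendsto s).comp hs)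
  rw [overflowFn_eq_lintegral, ← lintegral_congr h1]
  refine (lintegral_liminf_le fun k => ?_).trans ?_
  · have := measurable_backlog C
    fun_prop
  · refine liminf_le_of_frequently_le' (Frequently.of_forall fun k => ?_)
    rw [← overflowFn_eq_lintegral]
    exact hu k

lemma exists_isExponent (h : BddAbove (feasible p ν C)) : ∃ s, IsExponent p ν C s :=
  ⟨_, isClosed_feasible.csSup_mem ⟨0, zero_mem_feasible⟩ h, fun _ hx => le_csSup h hx⟩

lemma IsExponent.nonneg (h : IsExponent p ν C s) : 0 ≤ s := h.2 zero_mem_feasible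

lemma laplaceStieltjes_le_one (hν : ∀ᵐ t ∂ν, 0 ≤ t) (hs : 0 ≤ s) : laplaceStieltjes ν s ≤ 1 := by
  calc laplaceStieltjes ν s ≤ ∫⁻ _, 1 ∂ν := by
        refine lintegral_mono_ae (hν.mono fun t ht => ?_)
        rw [ENNReal.ofReal_le_one, Real.exp_le_one_iff]
        nlinarith
    _ = 1 := by simp

lemma laplaceStieltjes_ne_zero (ν : Measure ℝ) [IsProbabilityMeasure ν] (s : ℝ) :
    laplaceStieltjes ν s ≠ 0 := by
  intro h
  rw [laplaceStieltjes, lintegral_eq_zero_iff (by fun_prop)] at h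
  obtain ⟨t, ht⟩ := h.exists
  simp at ht
  exact absurd ht (not_le.2 (Real.exp_pos _))

lemma integrable_exp_of_overflowFn_ne_top (h : overflowFn p ν C s ≠ ∞) :
    Integrable (fun x => Real.exp (s * backlog C x)) (p.toMeasure.prod ν) := by
  have := measurable_backlog C
  refine ⟨by fun_prop, ?_⟩
  rw [hasFiniteIntegral_iff_ofReal (ae_of_all _ fun _ => (Real.exp_pos _).le),
    ← overflowFn_eq_lintegral]
  exact h.lt_top

lemma overflowFn_eq_ofReal_mgf
    (h : Integrable (fun x => Real.exp (s * backlog C x)) (p.toMeasure.prod ν)) :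
    overflowFn p ν C s = ENNReal.ofReal (mgf (backlog C) (p.toMeasure.prod ν) s) := by
  rw [overflowFn_eq_lintegral, mgf,
    ofReal_integral_eq_lintegral_ofReal h (ae_of_all _ fun _ => (Real.exp_pos _).le)]

/-- With zero backlog `f(C, ·)` would be constant `1` and every `s` feasible. -/
lemma not_ae_backlog_eq_zero (hbdd : BddAbove (feasible p ν C)) :
    ¬ ∀ᵐ x ∂(p.toMeasure.prod ν), backlog C x = 0 := by
  intro h
  obtain ⟨B, hB⟩ := hbdd
  have : B + 1 ∈ feasible p ν C := by
    change overflowFn p ν C (B + 1) ≤ 1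
    rw [overflowFn_eq_lintegral, lintegral_congr_ae (g := fun _ => 1)
      (h.mono fun x hx => by simp [hx])]
    simp
  linarith [hB this]

/-- Strict convexity of `f(N, ·)`: strictly between `0` and a feasible point, `f(N, s) < 1`. -/
lemma overflowFn_lt_one (hbdd : BddAbove (feasible p ν C)) (hs : 0 < s) (hss : s < s')
    (hs' : s' ∈ feasible p ν C) : overflowFn p ν C s < 1 := by
  have hf : overflowFn p ν C s' ≤ 1 := hs'
  have hi' := integrable_exp_of_overflowFn_ne_top (hf.trans_lt ENNReal.one_lt_top).ne
  have hYm := measurable_backlog C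
  have hs'0 : 0 < s' := hs.trans hss
  have hl1 : s / s' < 1 := (div_lt_one hs'0).2 hss
  have hl0 : 0 < s / s' := div_pos hs hs'0
  have hconv : ∀ y : ℝ, Real.exp (s * y) ≤ (1 - s / s') + s / s' * Real.exp (s' * y) := by
    intro y
    have := convexOn_exp.2 (Set.mem_univ (0 : ℝ)) (Set.mem_univ (s' * y)) (sub_nonneg.2 hl1.le)
      hl0.le (by ring)
    simp only [smul_eq_mul, mul_zero, zero_add, Real.exp_zero, mul_one] at this
    rwa [← mul_assoc, div_mul_cancel₀ _ hs'0.ne'] at this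
  have hi : Integrable (fun x => Real.exp (s * backlog C x)) (p.toMeasure.prod ν) := by
    refine Integrable.mono' ((integrable_const (1 - s / s')).add (hi'.const_mul (s / s')))
      (by fun_prop) (ae_of_all _ fun x => ?_)
    rw [Real.norm_of_nonneg (Real.exp_pos _).le]
    exact hconv _
  by_contra hge
  push Not at hge
  rw [overflowFn_eq_ofReal_mgf hi, ENNReal.one_le_ofReal] at hge
  rw [overflowFn_eq_ofReal_mgf hi', ENNReal.ofReal_le_one] at hf
  let g : ℕ × ℝ → ℝ := fun x =>
    (1 - s / s') + s / s' * Real.exp (s' * backlog C x) - Real.exp (s * backlog C x)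
  have hg0 : 0 ≤ g := fun x => sub_nonneg.2 (hconv _)
  have hA : Integrable (fun x => (1 - s / s') + s / s' * Real.exp (s' * backlog C x))
      (p.toMeasure.prod ν) := (integrable_const _).add (hi'.const_mul _)
  have hgi : Integrable g (p.toMeasure.prod ν) := hA.sub hi
  have hgint : ∫ x, g x ∂(p.toMeasure.prod ν) = 0 := by
    refine le_antisymm ?_ (integral_nonneg hg0)
    have : ∫ x, g x ∂(p.toMeasure.prod ν) = (1 - s / s') +
        s / s' * mgf (backlog C) (p.toMeasure.prod ν) s' -
          mgf (backlog C) (p.toMeasure.prod ν) s := by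
      simp only [g, mgf]
      rw [integral_sub hA hi,
        integral_add (integrable_const _) (hi'.const_mul _), integral_const_mul]
      simp
    rw [this]
    nlinarith
  refine not_ae_backlog_eq_zero hbdd ?_
  filter_upwards [(integral_eq_zero_iff_of_nonneg hg0 hgi).1 hgint] with x hx
  by_contra hne
  have := strictConvexOn_exp.2 (Set.mem_univ (0 : ℝ)) (Set.mem_univ (s' * backlog C x))
    (mul_ne_zero hs'0.ne' hne).symm (sub_pos.2 hl1) hl0 (by ring)
  simp only [smul_eq_mul, mul_zero, zero_add, Real.exp_zero, mul_one] at this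
  rw [← mul_assoc, div_mul_cancel₀ _ hs'0.ne'] at this
  simp only [g, Pi.zero_apply] at hx
  linarith

lemma overflowFn_le_expSum (hν : ∀ᵐ t ∂ν, 0 ≤ t) (hs : 0 ≤ s) :
    overflowFn p ν C s ≤ expSum p C s :=
  mul_le_of_le_one_left' (laplaceStieltjes_le_one hν hs)

lemma expSum_ne_top_of_mem_feasible (h : s ∈ feasible p ν C) : expSum p C s ≠ ∞ := by
  intro htop
  have h1 : laplaceStieltjes ν s * expSum p C s ≤ 1 := h
  rw [htop, ENNReal.mul_top (laplaceStieltjes_ne_zero ν s)] at h1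
  simp at h1

/-- The case `s > 0` of the stopping rule. -/
lemma isExponentBound_of_pos (hν : ∀ᵐ t ∂ν, 0 ≤ t) (hs : 0 < s) (hmin : MinimizesPenalty p s C)
    (hexp : IsExponent p ν C s) (hbdd : ∀ C', BddAbove (feasible p ν C'))
    (hfin : ∃ u > s, expSum p C u ≠ ∞) : IsExponentBound p ν s := by
  intro C' s' hs'
  by_contra hlt
  push Not at hlt
  have h1 := overflowFn_lt_one (hbdd C') hs hlt hs'
  have h2 : overflowFn p ν C s < 1 := by
    rw [MinimizesPenalty, if_neg hs.ne'] at hmin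
    exact (mul_le_mul_right (hmin C') _).trans_lt h1
  obtain ⟨u, hu, hfin⟩ := hfin
  have h3 := integrable_exp_of_overflowFn_ne_top
    ((overflowFn_le_expSum (C := C) hν (hs.trans hu).le).trans_lt hfin.lt_top).ne
  have hint : s ∈ interior (integrableExpSet (backlog C) (p.toMeasure.prod ν)) := by
    rw [mem_interior]
    refine ⟨Set.Ioo 0 u, fun v hv => ?_, isOpen_Ioo, hs, hu⟩
    have h0 : (0 : ℝ) ∈ integrableExpSet (backlog C) (p.toMeasure.prod ν) := by
      simp [integrableExpSet]
    exact convex_integrableExpSet.ordConnected.out h0 h3 ⟨hv.1.le, hv.2.le⟩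
  have hcont : ContinuousAt (mgf (backlog C) (p.toMeasure.prod ν)) s :=
    continuousOn_mgf.continuousAt (isOpen_interior.mem_nhds hint)
  rw [overflowFn_eq_ofReal_mgf (interior_subset hint : _), ENNReal.ofReal_lt_one] at h2
  have h4 := (hcont.eventually (gt_mem_nhds h2)).and (isOpen_interior.mem_nhds hint)
  have h5 : ∀ᶠ v in 𝓝[>] s, mgf (backlog C) (p.toMeasure.prod ν) v < 1 ∧
    v ∈ interior (integrableExpSet (backlog C) (p.toMeasure.prod ν)) :=
    h4.filter_mono nhdsWithin_le_nhds
  obtain ⟨v, ⟨hv1, hv2⟩, hv3⟩ := (h5.and self_mem_nhdsWithin).exists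
  have : v ∈ feasible p ν C := by
    change overflowFn p ν C v ≤ 1
    rw [overflowFn_eq_ofReal_mgf (interior_subset hv2 : _), ENNReal.ofReal_le_one]
    exact hv1.le
  exact absurd (hexp.2 this) (not_le.2 hv3)

lemma integrable_exp_len (h : expSum p C s ≠ ∞) :
    Integrable (fun x : ℕ × ℝ => Real.exp (s * C.len x.1)) (p.toMeasure.prod ν) := by
  have h1 : Integrable (fun i : ℕ => Real.exp (s * C.len i)) p.toMeasure := by
    refine ⟨(measurable_of_countable _).aestronglyMeasurable, ?_⟩
    rw [hasFiniteIntegral_iff_ofReal (ae_of_all _ fun _ => (Real.exp_pos _).le),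
      ← expSum_eq_lintegral]
    exact h.lt_top
  exact h1.comp_fst ν

lemma meanLen_eq_lintegral (p : PMF ℕ) (ν : Measure ℝ) [IsProbabilityMeasure ν] (C : PrefixCode) :
    meanLen p C = ∫⁻ x, ENNReal.ofReal (C.len x.1) ∂(p.toMeasure.prod ν) := by
  have := lintegral_prod_mul (μ := p.toMeasure) (ν := ν)
    (f := fun i => ENNReal.ofReal (C.len i)) (g := fun _ => 1)
    (measurable_of_countable _).aemeasurable (by fun_prop)
  simp only [mul_one, lintegral_one, measure_univ] at this
  rw [this, lintegral_countable', meanLen]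
  refine tsum_congr fun i => ?_
  rw [PMF.toMeasure_apply_singleton _ _ (measurableSet_singleton i), mul_comm,
    ENNReal.ofReal_natCast]

/-- The case `s = 0` of the stopping rule. If another code had a positive exponent, its mean
backlog, with the intermission time truncated at a large level `R`, would be negative; so would be
that of `C`, whose length is minimal in the mean, and this is the derivative at `0` of an upper
bound for `f(C, ·)`. The truncation makes the moment generating function finite on both
sides of `0`. -/
lemma isExponentBound_of_zero (hν : ∀ᵐ t ∂ν, 0 ≤ t) (hmin : ∀ C', meanLen p C ≤ meanLen p C')
    (hexp : IsExponent p ν C 0) (hbdd : ∀ C', BddAbove (feasible p ν C'))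
    (hfin : ∃ u > 0, expSum p C u ≠ ∞) : IsExponentBound p ν 0 := by
  intro C' s' hs'
  by_contra hlt
  push Not at hlt
  set P := p.toMeasure.prod ν with hP
  set t := s' / 2 with htdef
  have ht : 0 < t := by positivity
  have h1 : overflowFn p ν C' t < 1 := overflowFn_lt_one (hbdd C') ht (by linarith) hs'
  have hT : ∀ᵐ x ∂P, 0 ≤ x.2 := Measure.quasiMeasurePreserving_snd.ae hν
  have hLi := integrable_exp_len (ν := ν) (expSum_ne_top_of_mem_feasible (s := t) (C := C') h1.le)
  have hlenint : ∀ D : PrefixCode, ∀ v : ℝ, 0 < v → expSum p D v ≠ ∞ →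
      Integrable (fun x : ℕ × ℝ => (D.len x.1 : ℝ)) P := by
    intro D v hv hD
    have := measurable_len D
    refine Integrable.mono' ((integrable_exp_len (ν := ν) hD).const_mul (1 / v))
      (by fun_prop) (ae_of_all _ fun x => ?_)
    rw [Real.norm_of_nonneg (by positivity), one_div, ← div_eq_inv_mul, le_div_iff₀ hv]
    have := Real.add_one_le_exp (v * D.len x.1)
    linarith
  have hminint : ∀ R : ℕ, Integrable (fun x : ℕ × ℝ => min x.2 (R : ℝ)) P := by
    intro R
    refine Integrable.mono' (integrable_const (R : ℝ)) (by fun_prop) ?_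
    filter_upwards [hT] with x hx
    rw [Real.norm_of_nonneg (le_min hx (by positivity))]
    exact min_le_right _ _
  have hC'i := hlenint C' t ht (expSum_ne_top_of_mem_feasible (s := t) (C := C') h1.le)
  have hexpm : ∀ (D : PrefixCode) (v : ℝ) (R : ℕ),
      Measurable fun x : ℕ × ℝ => Real.exp (v * (D.len x.1 - min x.2 (R : ℝ))) := by
    intro D v R
    have := measurable_len D
    fun_prop
  have hexple : ∀ (D : PrefixCode) (v : ℝ) (R : ℕ), 0 ≤ v → ∀ᵐ x ∂P,
      ‖Real.exp (v * (D.len x.1 - min x.2 (R : ℝ)))‖ ≤ Real.exp (v * D.len x.1) := by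
    intro D v R hv
    filter_upwards [hT] with x hx
    rw [Real.norm_of_nonneg (Real.exp_pos _).le, Real.exp_le_exp]
    have : 0 ≤ min x.2 (R : ℝ) := le_min hx (by positivity)
    nlinarith
  obtain ⟨R, hR⟩ : ∃ R : ℕ, ∫ x, Real.exp (t * (C'.len x.1 - min x.2 (R : ℝ))) ∂P < 1 := by
    have hlim : Tendsto (fun R : ℕ => ∫ x, Real.exp (t * (C'.len x.1 - min x.2 (R : ℝ))) ∂P) atTop
        (𝓝 (∫ x, Real.exp (t * backlog C' x) ∂P)) := by
      refine tendsto_integral_of_dominated_convergence _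
        (fun R => (hexpm C' t R).aestronglyMeasurable) hLi (fun R => hexple C' t R ht.le)
        (ae_of_all _ fun x => ?_)
      refine tendsto_const_nhds.congr' ?_
      filter_upwards [eventually_ge_atTop ⌈x.2⌉₊] with R hR
      rw [min_eq_left ((Nat.le_ceil _).trans (by exact_mod_cast hR)), backlog]
    have h2 : ∫ x, Real.exp (t * backlog C' x) ∂P < 1 := by
      have h3 := h1
      rw [overflowFn_eq_ofReal_mgf (integrable_exp_of_overflowFn_ne_top
        (h1.trans ENNReal.one_lt_top).ne), ENNReal.ofReal_lt_one] at h3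
      exact h3
    exact (hlim.eventually (gt_mem_nhds h2)).exists
  have hneg' : ∫ x : ℕ × ℝ, ((C'.len x.1 : ℝ) - min x.2 (R : ℝ)) ∂P < 0 := by
    have hZ : Integrable (fun x : ℕ × ℝ => t * ((C'.len x.1 : ℝ) - min x.2 (R : ℝ))) P :=
      (hC'i.sub (hminint R)).const_mul t
    have h2 : ∫ x : ℕ × ℝ, (1 + t * ((C'.len x.1 : ℝ) - min x.2 (R : ℝ))) ∂P ≤
        ∫ x, Real.exp (t * (C'.len x.1 - min x.2 (R : ℝ))) ∂P := by
      refine integral_mono ((integrable_const _).add hZ)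
        (Integrable.mono' hLi (hexpm C' t R).aestronglyMeasurable (hexple C' t R ht.le)) fun x => ?_
      have := Real.add_one_le_exp (t * ((C'.len x.1 : ℝ) - min x.2 (R : ℝ)))
      simp only
      linarith
    rw [integral_add (integrable_const _) hZ,
      integral_const_mul] at h2
    simp only [integral_const, probReal_univ, smul_eq_mul, mul_one] at h2
    by_contra hge
    push Not at hge
    have := mul_nonneg ht.le hge
    linarith
  obtain ⟨u, hu, hfin⟩ := hfin
  have hCi := hlenint C u hu hfin
  have hneg : ∫ x : ℕ × ℝ, ((C.len x.1 : ℝ) - min x.2 (R : ℝ)) ∂P < 0 := by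
    refine lt_of_le_of_lt ?_ hneg'
    rw [integral_sub hCi (hminint R), integral_sub hC'i (hminint R)]
    have h2 := hmin C'
    rw [meanLen_eq_lintegral p ν, meanLen_eq_lintegral p ν,
      ← ofReal_integral_eq_lintegral_ofReal hCi (ae_of_all _ fun _ => by positivity),
      ← ofReal_integral_eq_lintegral_ofReal hC'i (ae_of_all _ fun _ => by positivity),
      ENNReal.ofReal_le_ofReal_iff (integral_nonneg fun _ => by positivity)] at h2
    linarith
  let W : ℕ × ℝ → ℝ := fun x => (C.len x.1 : ℝ) - min x.2 R
  have hWu : u ∈ integrableExpSet W P :=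
    Integrable.mono' (integrable_exp_len (ν := ν) hfin) (hexpm C u R).aestronglyMeasurable
      (hexple C u R hu.le)
  have hW1 : (-1 : ℝ) ∈ integrableExpSet W P := by
    refine Integrable.mono' (integrable_const (Real.exp R)) (hexpm C (-1) R).aestronglyMeasurable
      (ae_of_all _ fun x => ?_)
    rw [Real.norm_of_nonneg (Real.exp_pos _).le, Real.exp_le_exp]
    have h2 := min_le_right x.2 (R : ℝ)
    have h3 : (0 : ℝ) ≤ C.len x.1 := by positivity
    linarith
  have hW0 : (0 : ℝ) ∈ interior (integrableExpSet W P) := by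
    rw [mem_interior]
    refine ⟨Set.Ioo (-1) u, fun v hv => ?_, isOpen_Ioo, by norm_num, hu⟩
    exact convex_integrableExpSet.ordConnected.out hW1 hWu ⟨hv.1.le, hv.2.le⟩
  have hder := hasDerivAt_mgf hW0
  simp only [zero_mul, Real.exp_zero, mul_one] at hder
  rw [hasDerivAt_iff_tendsto_slope] at hder
  have h4 : ∀ᶠ v in 𝓝[>] (0 : ℝ), slope (mgf W P) 0 v < 0 :=
    (hder.eventually (gt_mem_nhds hneg)).filter_mono (nhdsWithin_mono _ fun v hv => ne_of_gt hv)
  have h5 : ∀ᶠ v in 𝓝[>] (0 : ℝ), v ∈ interior (integrableExpSet W P) :=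
    Filter.Eventually.filter_mono nhdsWithin_le_nhds (isOpen_interior.mem_nhds hW0)
  obtain ⟨v, ⟨hv1, hv2⟩, hv3⟩ := ((h4.and h5).and self_mem_nhdsWithin).exists
  have hv0 : (0 : ℝ) < v := hv3
  have hv4 : mgf W P v < 1 := by
    rw [slope_def_field, mgf_zero, sub_zero, div_neg_iff] at hv1
    rcases hv1 with h | h <;> linarith
  have : v ∈ feasible p ν C := by
    change overflowFn p ν C v ≤ 1
    rw [overflowFn_eq_lintegral]
    calc _ ≤ ∫⁻ x, ENNReal.ofReal (Real.exp (v * W x)) ∂P := by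
          refine lintegral_mono fun x => ENNReal.ofReal_le_ofReal (Real.exp_le_exp.2 ?_)
          have := min_le_left x.2 (R : ℝ)
          simp only [W, backlog]
          nlinarith
      _ = ENNReal.ofReal (mgf W P v) := by
          rw [mgf, ofReal_integral_eq_lintegral_ofReal (interior_subset hv2 : _)
            (ae_of_all _ fun _ => (Real.exp_pos _).le)]
      _ ≤ 1 := by rw [ENNReal.ofReal_le_one]; exact hv4.le
  exact absurd (hexp.2 this) (not_le.2 hv0)

/-- The stopping rule is correct: a pass that returns the value `s` it was entered with has found
an optimal code, provided that `f(C, ·)` does not jump to `∞` at `s`. -/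
lemma isExponentBound_of_stop (hν : ∀ᵐ t ∂ν, 0 ≤ t) (hmin : MinimizesPenalty p s C)
    (hexp : IsExponent p ν C s) (hbdd : ∀ C', BddAbove (feasible p ν C'))
    (hfin : ∃ u > s, expSum p C u ≠ ∞) : IsExponentBound p ν s := by
  rcases hexp.nonneg.eq_or_lt with rfl | hs
  · rw [MinimizesPenalty, if_pos rfl] at hmin
    exact isExponentBound_of_zero hν hmin hexp hbdd hfin
  · exact isExponentBound_of_pos hν hs hmin hexp hbdd hfin

end Overflow

/-! ### Existence of minimizers -/

/-- The expected normalized penalty `∑ p(i) (1 + b + ⋯ + b^{n(i)-1})`, with values in `[0, ∞]`. -/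
noncomputable def cost (p : PMF ℕ) (b : ℝ) (n : ℕ → ℕ) : ℝ≥0∞ :=
  ∑' i, p i * ENNReal.ofReal (penalty b (n i))

section Cost

variable {p : PMF ℕ} {b s : ℝ} {n : ℕ → ℕ} {C : PrefixCode}

lemma ofReal_toReal_mul (p : PMF ℕ) (i : ℕ) (x : ℝ) :
    p i * ENNReal.ofReal x = ENNReal.ofReal ((p i).toReal * x) := by
  rw [ENNReal.ofReal_mul ENNReal.toReal_nonneg, ENNReal.ofReal_toReal (p.apply_ne_top i)]

lemma cost_ne_top_iff (hb : 1 ≤ b) :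
    cost p b n ≠ ∞ ↔ Summable fun i => (p i).toReal * penalty b (n i) := by
  have h0 : ∀ i, 0 ≤ (p i).toReal * penalty b (n i) := fun i =>
    mul_nonneg ENNReal.toReal_nonneg (penalty_nonneg hb _)
  constructor
  · intro h
    refine (ENNReal.summable_toReal h).congr fun i => ?_
    rw [ofReal_toReal_mul, ENNReal.toReal_ofReal (h0 i)]
  · intro h
    simp only [cost, ofReal_toReal_mul]
    rw [← ENNReal.ofReal_tsum_of_nonneg h0 h]
    exact ENNReal.ofReal_ne_top

lemma cost_eq_ofReal (hb : 1 ≤ b) (h : Summable fun i => (p i).toReal * penalty b (n i)) :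
    cost p b n = ENNReal.ofReal (∑' i, (p i).toReal * penalty b (n i)) := by
  rw [ENNReal.ofReal_tsum_of_nonneg (fun i =>
    mul_nonneg ENNReal.toReal_nonneg (penalty_nonneg hb _)) h]
  simp only [cost, ofReal_toReal_mul]

lemma expSum_eq_cost (hs : 0 ≤ s) :
    expSum p C s = 1 + ENNReal.ofReal (Real.exp s - 1) * cost p (Real.exp s) C.len := by
  have hb : 1 ≤ Real.exp s := Real.one_le_exp hs
  rw [expSum, cost, ← ENNReal.tsum_mul_left, ← p.tsum_coe, ← ENNReal.tsum_add]
  refine tsum_congr fun i => ?_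
  rw [mul_comm s, Real.exp_nat_mul, pow_eq_penalty,
    ENNReal.ofReal_add zero_le_one (mul_nonneg (by linarith) (penalty_nonneg hb _)),
    ENNReal.ofReal_mul (by linarith), ENNReal.ofReal_one]
  ring

lemma meanLen_eq_cost : meanLen p C = cost p 1 C.len := by
  simp [meanLen, cost, penalty]

lemma minimizesPenalty_iff (hs : 0 ≤ s) :
    MinimizesPenalty p s C ↔
      ∀ C' : PrefixCode, cost p (Real.exp s) C.len ≤ cost p (Real.exp s) C'.len := by
  rcases hs.eq_or_lt with rfl | hs
  · simp only [MinimizesPenalty, if_true, meanLen_eq_cost, Real.exp_zero]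
  · have h1 : 0 < Real.exp s - 1 := by
      have := Real.one_lt_exp_iff.2 hs
      linarith
    simp only [MinimizesPenalty, if_neg hs.ne', expSum_eq_cost hs.le]
    refine forall_congr' fun C' => ?_
    rw [ENNReal.add_le_add_iff_left ENNReal.one_ne_top,
      ENNReal.mul_le_mul_iff_right (by simpa using h1) ENNReal.ofReal_ne_top]

lemma summable_toReal_pmf (p : PMF ℕ) : Summable fun i => (p i).toReal :=
  ENNReal.summable_toReal p.tsum_coe_ne_top

/-- A minimizer of a finite penalty has optimal lengths; here the converse of Kraft's inequality
turns competing lengths into codes. -/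
lemma isOptLen_of_minimizesPenalty (hs : 0 ≤ s) (h : MinimizesPenalty p s C) {g : ℕ → ℕ}
    (hg : KraftLE g) (hgs : Summable fun i => (p i).toReal * penalty (Real.exp s) (g i)) :
    IsOptLen (fun i => (p i).toReal) (Real.exp s) C.len := by
  have hb : 1 ≤ Real.exp s := Real.one_le_exp hs
  rw [minimizesPenalty_iff hs] at h
  have hle : ∀ n', KraftLE n' → cost p (Real.exp s) C.len ≤ cost p (Real.exp s) n' := by
    intro n' hn'
    obtain ⟨C', rfl⟩ := hn'.exists_prefixCode
    exact h C'
  have hC : Summable fun i => (p i).toReal * penalty (Real.exp s) (C.len i) :=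
    (cost_ne_top_iff hb).1 ((hle g hg).trans_lt ((cost_ne_top_iff hb).2 hgs).lt_top).ne
  refine ⟨C.kraftLE, ?_, hC, fun n' hn' hs' => ?_⟩
  · refine ((summable_toReal_pmf p).add (hC.mul_left (Real.exp s - 1))).congr fun i => ?_
    rw [pow_eq_penalty]; ring
  · have := hle n' hn'
    rwa [cost_eq_ofReal hb hC, cost_eq_ofReal hb hs', ENNReal.ofReal_le_ofReal_iff
      (tsum_nonneg fun i => mul_nonneg ENNReal.toReal_nonneg (penalty_nonneg hb _))] at this

lemma le_of_cost_le (hb : 1 ≤ b) {c : ℝ≥0∞} (hc : c ≠ ∞) (h : cost p b n ≤ c) {i : ℕ}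
    (hi : p i ≠ 0) : n i ≤ ⌊(c / p i).toReal⌋₊ := by
  have h1 : p i * ENNReal.ofReal (penalty b (n i)) ≤ c := (ENNReal.le_tsum i).trans h
  have h2 : (n i : ℝ≥0∞) ≤ c / p i := by
    rw [ENNReal.le_div_iff_mul_le (Or.inl hi) (Or.inl (p.apply_ne_top i)), mul_comm]
    refine le_trans ?_ h1
    gcongr
    rw [← ENNReal.ofReal_natCast]
    exact ENNReal.ofReal_le_ofReal (cast_le_penalty hb _)
  have h3 := ENNReal.toReal_mono (ENNReal.div_ne_top hc hi) h2
  exact Nat.le_floor (by simpa using h3)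

/-- If every symbol has positive probability, a minimizer exists: lengths of bounded cost satisfying
Kraft's inequality form a compact set in the product topology, and the cost is lower
semicontinuous. -/
lemma exists_minimizesPenalty_of_pos (hp : ∀ i, p i ≠ 0) (hs : 0 ≤ s) :
    ∃ C, MinimizesPenalty p s C := by
  simp only [minimizesPenalty_iff hs]
  set b := Real.exp s with hbdef
  have hb : 1 ≤ b := Real.one_le_exp hs
  obtain ⟨D, -⟩ := kraftLE_succ.exists_prefixCode
  by_cases htop : ∀ C' : PrefixCode, cost p b C'.len = ∞
  · exact ⟨D, fun C' => by rw [htop C']; exact le_top⟩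
  push Not at htop
  obtain ⟨C₀, hC₀⟩ := htop
  let K : Set (ℕ → ℕ) := (Set.pi Set.univ fun i => Set.Iic ⌊(cost p b C₀.len / p i).toReal⌋₊) ∩
    {n | ∀ t : Finset ℕ, ∑ i ∈ t, (2⁻¹ : ℝ) ^ n i ≤ 1}
  have hev : ∀ (i : ℕ) {α : Type} [TopologicalSpace α] (f : ℕ → α),
      Continuous fun n : ℕ → ℕ => f (n i) := fun i _ _ f =>
    (continuous_of_discreteTopology (f := f)).comp (continuous_apply i)
  have hclosed : IsClosed {n : ℕ → ℕ | ∀ t : Finset ℕ, ∑ i ∈ t, (2⁻¹ : ℝ) ^ n i ≤ 1} := by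
    simp only [Set.ofPred_forall]
    exact isClosed_iInter fun t => isClosed_le
      (continuous_finsetSum _ fun i _ => hev i fun m => (2⁻¹ : ℝ) ^ m) continuous_const
  have hK : IsCompact K :=
    (isCompact_univ_pi fun i => (Set.finite_Iic _).isCompact).inter_right hclosed
  have hmem : ∀ C : PrefixCode, cost p b C.len ≤ cost p b C₀.len → C.len ∈ K := fun C hC =>
    ⟨fun i _ => le_of_cost_le hb hC₀ hC (hp i), C.kraftLE.sum_le⟩
  have hlsc : LowerSemicontinuous fun n : ℕ → ℕ => cost p b n :=
    lowerSemicontinuous_tsum fun i =>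
      (hev i fun m => p i * ENNReal.ofReal (penalty b m)).lowerSemicontinuous
  obtain ⟨n, hnK, hn⟩ := (hlsc.lowerSemicontinuousOn K).exists_isMinOn ⟨_, hmem C₀ le_rfl⟩ hK
  have hkraft : KraftLE n := by
    have h1 : Summable fun i => (2⁻¹ : ℝ) ^ n i :=
      summable_of_sum_le (fun i => by positivity) hnK.2
    exact ⟨h1, h1.tsum_le_of_sum_le hnK.2⟩
  obtain ⟨C, rfl⟩ := hkraft.exists_prefixCode
  refine ⟨C, fun C' => ?_⟩
  by_cases hC' : cost p b C'.len ≤ cost p b C₀.len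
  · exact hn (hmem C' hC')
  · exact (hn (hmem C₀ le_rfl)).trans (not_le.1 hC').le

lemma cost_eq_sum {F : Finset ℕ} (hF : ∀ i ∉ F, p i = 0) :
    cost p b n = ∑ i : F, p i * ENNReal.ofReal (penalty b (n i)) := by
  rw [cost, tsum_eq_sum (s := F) (fun i hi => by rw [hF i hi, zero_mul]),
    ← Finset.sum_coe_sort F fun i => p i * ENNReal.ofReal (penalty b (n i))]

/-- For finitely many symbols of positive probability only finitely many lengths of these symbols
compete. Compactness is of no use here, because Kraft's inequality has to be strict on these
symbols. -/
lemma exists_minimizesPenalty_of_finite {F : Finset ℕ} (hF : ∀ i, i ∈ F ↔ p i ≠ 0) (hs : 0 ≤ s) :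
    ∃ C, MinimizesPenalty p s C := by
  simp only [minimizesPenalty_iff hs]
  set b := Real.exp s with hbdef
  have hb : 1 ≤ b := Real.one_le_exp hs
  have hF' : ∀ i ∉ F, p i = 0 := fun i hi => by simpa [hF] using hi
  obtain ⟨C₀, -⟩ := kraftLE_succ.exists_prefixCode
  have hC₀ : cost p b C₀.len ≠ ∞ := by
    rw [cost_eq_sum hF']
    exact ENNReal.sum_ne_top.2 fun i _ =>
      ENNReal.mul_ne_top (p.apply_ne_top _) ENNReal.ofReal_ne_top
  let A : Set (F → ℕ) := (fun C : PrefixCode => fun i : F => C.len i) ''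
    {C | cost p b C.len ≤ cost p b C₀.len}
  have hA : A.Finite := by
    refine (Set.Finite.pi (t := fun i : F => Set.Iic ⌊(cost p b C₀.len / p i).toReal⌋₊)
      fun i => Set.finite_Iic _).subset ?_
    rintro _ ⟨C, hC, rfl⟩ i -
    exact le_of_cost_le hb hC₀ hC ((hF i).1 i.2)
  obtain ⟨_, ⟨C, hC, rfl⟩, hmin⟩ := Set.exists_min_image A
    (fun v => ∑ i : F, p i * ENNReal.ofReal (penalty b (v i))) hA
    ⟨_, C₀, le_refl (cost p b C₀.len), rfl⟩
  refine ⟨C, fun C' => ?_⟩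
  by_cases hC' : cost p b C'.len ≤ cost p b C₀.len
  · have := hmin _ ⟨C', hC', rfl⟩
    rwa [← cost_eq_sum hF', ← cost_eq_sum hF'] at this
  · exact le_trans hC (not_le.1 hC').le

end Cost

/-! ### Runs of the procedure -/

lemma EntersLoop.le_of_isExponentBound {p : PMF ℕ} {ν : Measure ℝ} {s₀ : ℝ}
    (hb : IsExponentBound p ν s₀) {s : ℝ} (h : EntersLoop p ν s₀ s) : s ≤ s₀ := by
  cases h with
  | start => exact le_rfl
  | next _ h _ => exact hb _ h.exponent.1

section Procedure

variable {p : PMF ℕ} {ν : Measure ℝ} [IsProbabilityMeasure ν] {s₀ : ℝ}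

/-- An infinite execution of the procedure: pass `j + 1` takes the value `s j` to `s (j + 1)` by
means of the code `C (j + 1)`. -/
structure IsRun (p : PMF ℕ) (ν : Measure ℝ) (s₀ : ℝ) (s : ℕ → ℝ) (C : ℕ → PrefixCode) : Prop where
  zero : s 0 = s₀
  pass : ∀ j, IsPass p ν (s j) (C (j + 1)) (s (j + 1))
  ne : ∀ j, s (j + 1) ≠ s j

namespace IsRun

variable {s : ℕ → ℝ} {C : ℕ → PrefixCode}

lemma nonneg (h : IsRun p ν s₀ s C) (j : ℕ) : 0 ≤ s (j + 1) := (h.pass j).exponent.nonneg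

/-- From the first computed exponent on, the values increase: `N_j` is feasible at its exponent
`s_j`, hence so is the code `N_{j+1}` minimizing there. -/
lemma strictMono (h : IsRun p ν s₀ s C) : StrictMono fun j => s (j + 1) := by
  refine strictMono_nat_of_lt_succ fun j => lt_of_le_of_ne ?_ (h.ne (j + 1)).symm
  have h1 := h.pass (j + 1)
  rcases (h.nonneg j).eq_or_lt with h0 | h0
  · rw [← h0]; exact h.nonneg (j + 1)
  · refine h1.exponent.2 ?_
    have h2 := h1.minimizes
    rw [MinimizesPenalty, if_neg h0.ne'] at h2
    exact (mul_le_mul_right (h2 (C (j + 1))) _).trans (h.pass j).exponent.1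

/-- The exponents of a run are pairwise different, so the functions `f(N_j, ·)` are not, from some
pass on, those of finitely many length functions. -/
lemma not_finite (h : IsRun p ν s₀ s C) (J : ℕ) {Φ : Set (ℕ → ℕ)} (hΦ : Φ.Finite)
    (hmem : ∀ j ≥ J, ∃ n ∈ Φ, ∀ t, expSum p (C (j + 1)) t =
      ∑' i, p i * ENNReal.ofReal (Real.exp (t * n i))) : False := by
  choose! f hf hf' using hmem
  refine Set.infinite_of_injective_forall_mem (f := fun t => f (J + t)) ?_
    (fun t => hf (J + t) (by omega)) hΦ
  intro t u htu
  have h1 : feasible p ν (C (J + t + 1)) = feasible p ν (C (J + u + 1)) := by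
    ext v
    change _ * _ ≤ (1 : ℝ≥0∞) ↔ _ * _ ≤ (1 : ℝ≥0∞)
    rw [hf' (J + t) (by omega), hf' (J + u) (by omega)]
    simp only at htu
    rw [htu]
  have h2 := (h.pass (J + t)).exponent
  have h3 := (h.pass (J + u)).exponent
  rw [IsExponent, h1] at h2
  have := h.strictMono.injective (h2.unique h3 : s (J + t + 1) = s (J + u + 1))
  omega

end IsRun

lemma EntersLoop.nonneg (hs₀ : 0 ≤ s₀) {s : ℝ} (h : EntersLoop p ν s₀ s) : 0 ≤ s := by
  cases h with
  | start => exact hs₀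
  | next _ h _ => exact h.exponent.nonneg

lemma terminatesWithOptimalCode_of (hs₀ : 0 ≤ s₀) (hbdd : ∀ C, BddAbove (feasible p ν C))
    (hex : ∀ s, 0 ≤ s → ∃ C, MinimizesPenalty p s C)
    (hopt : ∀ s C, EntersLoop p ν s₀ s → MinimizesPenalty p s C → IsExponent p ν C s →
      IsExponentBound p ν s)
    (hrun : ∀ s C, ¬ IsRun p ν s₀ s C) : TerminatesWithOptimalCode p ν s₀ where
  exists_minimizer s hs := hex s (hs.nonneg hs₀)
  exists_exponent s C _ _ := exists_isExponent (hbdd C)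
  no_infinite_run := by
    rintro ⟨s, C, h0, h⟩
    exact hrun s C ⟨h0, fun j => (h j).1, fun j => (h j).2⟩
  optimal_of_stop s C hs hpass := ⟨s, hpass.exponent, hopt s C hs hpass.minimizes hpass.exponent⟩

lemma expSum_ne_top_of_summable {C : PrefixCode} {u : ℝ}
    (h : Summable fun i => (p i).toReal * Real.exp u ^ C.len i) : expSum p C u ≠ ∞ := by
  have e : expSum p C u = ∑' i, ENNReal.ofReal ((p i).toReal * Real.exp u ^ C.len i) := by
    refine tsum_congr fun i => ?_
    rw [ofReal_toReal_mul, mul_comm u, Real.exp_nat_mul]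
  rw [e, ← ENNReal.ofReal_tsum_of_nonneg (fun i => by positivity) h]
  exact ENNReal.ofReal_ne_top


/-- Minimizers for all bases up to `e^S` are bounded symbol by symbol, as soon as some code has
finite cost for the base `e^S`. -/
lemma len_le_of_minimizesPenalty {S s : ℝ} {C : PrefixCode} {g : ℕ → ℕ} (hg : KraftLE g)
    (hgs : Summable fun i => (p i).toReal * penalty (Real.exp S) (g i)) (hs : 0 ≤ s) (hsS : s ≤ S)
    (h : MinimizesPenalty p s C) {i : ℕ} (hi : p i ≠ 0) :
    C.len i ≤ ⌊(cost p (Real.exp S) g / p i).toReal⌋₊ := by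
  obtain ⟨D, rfl⟩ := hg.exists_prefixCode
  refine le_of_cost_le (Real.one_le_exp hs)
    ((cost_ne_top_iff (Real.one_le_exp (hs.trans hsS))).2 hgs) ?_ hi
  refine ((minimizesPenalty_iff hs).1 h D).trans (ENNReal.tsum_le_tsum fun j => ?_)
  gcongr
  exact Finset.sum_le_sum fun m _ => pow_le_pow_left₀ (Real.exp_pos _).le (Real.exp_le_exp.2 hsS) m

lemma summable_mul_penalty_mono {q : ℕ → ℝ} (hq : ∀ i, 0 ≤ q i) {b a : ℝ} (hb : 1 ≤ b) (hba : b ≤ a)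
    {g : ℕ → ℕ} (h : Summable fun i => q i * penalty a (g i)) :
    Summable fun i => q i * penalty b (g i) :=
  h.of_nonneg_of_le (fun i => mul_nonneg (hq i) (penalty_nonneg hb _)) fun i =>
    mul_le_mul_of_nonneg_left
      (Finset.sum_le_sum fun m _ => pow_le_pow_left₀ (by linarith) hba m) (hq i)

end Procedure

/-! ### Light-tailed sources -/

section Light

variable {p : PMF ℕ} {ν : Measure ℝ} [IsProbabilityMeasure ν] {s₀ : ℝ}

lemma IsLightTailed.exists_lightTail {a : ℝ} (ha : 0 ≤ a) (h : IsLightTailed p a) :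
    ∃ r, LightTail (fun i => (p i).toReal) a r := by
  obtain ⟨r, hr⟩ := h
  have e : ∀ j m, p (j + 1 + m) * ENNReal.ofReal (a ^ (m + 1)) =
      ENNReal.ofReal ((p (m + (j + 1))).toReal * a ^ (m + 1)) := by
    intro j m
    rw [ofReal_toReal_mul, add_comm m (j + 1)]
  have h0 : ∀ j m : ℕ, 0 ≤ (p (m + (j + 1))).toReal * a ^ (m + 1) := fun j m => by positivity
  have hs : ∀ j > r, Summable fun m => (p (m + (j + 1))).toReal * a ^ (m + 1) := by
    intro j hj
    have h1 := (hr j hj 0 (by omega)).2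
    simp only [e] at h1
    refine (ENNReal.summable_toReal (h1.trans_lt (p.apply_lt_top 0)).ne).congr fun m => ?_
    rw [ENNReal.toReal_ofReal (h0 j m)]
  refine ⟨r, fun j hj i hi => ENNReal.toReal_mono (p.apply_ne_top i) (hr j hj i hi).1, hs,
    fun j hj i hi => ?_⟩
  have h1 := (hr j hj i hi).2
  simp only [e] at h1
  rw [← ENNReal.ofReal_tsum_of_nonneg (h0 j) (hs j hj)] at h1
  exact (ENNReal.ofReal_le_iff_le_toReal (p.apply_ne_top i)).1 h1

lemma IsLightTailed.pos_or_finite {a : ℝ} (h : IsLightTailed p a) :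
    (∀ i, p i ≠ 0) ∨ {i | p i ≠ 0}.Finite := by
  obtain ⟨r, hr⟩ := h
  by_cases hfin : {i | p i ≠ 0}.Finite
  · exact Or.inr hfin
  · refine Or.inl fun i hi => ?_
    obtain ⟨j, hj, hlt⟩ := Set.Infinite.exists_gt hfin (max i r)
    have h1 := (hr j (by omega) i (by omega)).1
    rw [hi] at h1
    exact hj (by simpa using h1)

lemma LightTail.summable_mul_pow {q : ℕ → ℝ} {a : ℝ} {r : ℕ} (h : LightTail q a r) :
    Summable fun i => q i * a ^ i := by
  rw [← summable_nat_add_iff (r + 2)]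
  refine ((h.summable (r + 1) (by omega)).mul_right (a ^ (r + 1))).congr fun m => ?_
  rw [mul_assoc, ← pow_add]
  congr 2
  omega

lemma LightTail.summable_penalty_succ {q : ℕ → ℝ} {a : ℝ} {r : ℕ} (h : LightTail q a r)
    (hq : ∀ i, 0 ≤ q i) (ha : 1 < a) : Summable fun i => q i * penalty a (i + 1) := by
  refine (h.summable_mul_pow.mul_right (a / (a - 1))).of_nonneg_of_le
    (fun i => mul_nonneg (hq i) (penalty_nonneg ha.le _)) fun i => ?_
  refine (mul_le_mul_of_nonneg_left (penalty_le_pow_div ha ha.le le_rfl (i + 1)) (hq i)).trans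
    (le_of_eq ?_)
  rw [pow_succ]; ring

/-- Symbols of zero probability do not matter, so with finitely many others the lengths of a
minimizer can be replaced by lengths from a finite set. -/
lemma terminates_of_finite_support (hν : ∀ᵐ t ∂ν, 0 ≤ t) (hs₀ : 0 ≤ s₀)
    (hb : IsExponentBound p ν s₀) (hfin : {i | p i ≠ 0}.Finite) :
    TerminatesWithOptimalCode p ν s₀ := by
  set F := hfin.toFinset with hFdef
  have hF : ∀ i, i ∈ F ↔ p i ≠ 0 := fun i => by simp [hFdef]
  have hsumm : ∀ f : ℕ → ℝ, Summable fun i => (p i).toReal * f i := fun f =>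
    summable_of_ne_finset_zero (s := F) fun i hi => by
      have : p i = 0 := by simpa [hF] using hi
      simp [this]
  have hbdd : ∀ C, BddAbove (feasible p ν C) := fun C => ⟨s₀, hb C⟩
  refine terminatesWithOptimalCode_of hs₀ hbdd
    (fun s hs => exists_minimizesPenalty_of_finite hF hs) (fun s C _ hmin hexp => ?_)
    fun s C hrun => ?_
  · exact isExponentBound_of_stop hν hmin hexp hbdd
      ⟨s + 1, by linarith, expSum_ne_top_of_summable (hsumm _)⟩
  · obtain ⟨M, hM⟩ : ∃ M, ∀ i ∈ F, i < M := ⟨F.sup id + 1, fun i hi =>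
      Nat.lt_succ_of_le (Finset.le_sup (f := id) hi)⟩
    classical
    -- lengths outside the support are arbitrary; these make the lengths run with period one
    let B : ℕ → ℕ := fun i => ⌊(cost p (Real.exp s₀) (fun t => t + 1) / p i).toReal⌋₊
    refine hrun.not_finite 1 (finite_setOf_eventually_period (M := M + 1) (k := 1)
      (max ((Finset.range (M + 1)).sup B) M) le_rfl (by omega)) fun j hj =>
      ⟨fun i => if i ∈ F then (C (j + 1)).len i else if i < M then 0 else i, ⟨fun i hi => ?_,
        fun i hi => ?_⟩, fun t => ?_⟩
    · simp only
      split_ifs with h1 h2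
      · obtain ⟨m, rfl⟩ : ∃ m, j = m + 1 := ⟨j - 1, by omega⟩
        have h3 := len_le_of_minimizesPenalty (S := s₀) kraftLE_succ (hsumm _) (hrun.nonneg m)
          (hb _ (hrun.pass m).exponent.1) (hrun.pass (m + 1)).minimizes ((hF i).1 h1)
        have h4 : B i ≤ (Finset.range (M + 1)).sup B := Finset.le_sup (Finset.mem_range.2 hi)
        exact le_trans (h3.trans h4) (le_max_left _ _)
      · exact Nat.zero_le _
      · exact le_max_of_le_right (by omega)
    · have h1 : i ∉ F := fun h => by have := hM i h; omega
      have h2 : i + 1 ∉ F := fun h => by have := hM _ h; omega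
      simp [h1, h2, show ¬ i < M by omega, show ¬ i + 1 < M by omega]
    · refine tsum_congr fun i => ?_
      by_cases hi : i ∈ F
      · simp [hi]
      · have : p i = 0 := by simpa [hF] using hi
        simp [this]

/-- For a base below `e^{s₀}`, the lengths of a minimizer are, up to exchanging equally likely
symbols, unary from a fixed index on. -/
lemma exists_unary_lengths {r : ℕ} (hL : LightTail (fun i => (p i).toReal) (Real.exp s₀) r)
    (hpos : ∀ i, p i ≠ 0) {s : ℝ} (hs : 0 ≤ s) (hss : s < s₀) {C : PrefixCode}
    (hmin : MinimizesPenalty p s C) : ∃ σ : Equiv.Perm ℕ, (∀ i, p (σ i) = p i) ∧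
      (∀ j ≥ r + 4, C.len (σ (j + 1)) = C.len (σ j) + 1) ∧
      ∀ t, expSum p C t = ∑' i, p i * ENNReal.ofReal (Real.exp (t * C.len (σ i))) := by
  have hq : ∀ i, 0 < (p i).toReal := fun i => ENNReal.toReal_pos (hpos i) (p.apply_ne_top i)
  have hb : 1 ≤ Real.exp s := Real.one_le_exp hs
  have hlt : Real.exp s < Real.exp s₀ := Real.exp_lt_exp.2 hss
  have hopt := isOptLen_of_minimizesPenalty hs hmin kraftLE_succ
    (summable_mul_penalty_mono (fun i => (hq i).le) hb hlt.le
      (hL.summable_penalty_succ (fun i => (hq i).le) (hb.trans_lt hlt)))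
  obtain ⟨σ, h1, -, h2⟩ := hL.exists_perm_unary hq (summable_toReal_pmf p) hb hlt hopt
  have h3 : ∀ i, p (σ i) = p i := fun i =>
    (ENNReal.toReal_eq_toReal_iff' (p.apply_ne_top _) (p.apply_ne_top _)).1 (h1 i)
  refine ⟨σ, h3, h2, fun t => ?_⟩
  rw [expSum, ← σ.tsum_eq]
  simp only [h3]

lemma terminates_of_lightTailed (hν : ∀ᵐ t ∂ν, 0 ≤ t) (hs₀ : 0 < s₀)
    (hlight : IsLightTailed p (Real.exp s₀)) (hb : IsExponentBound p ν s₀)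
    (hpos : ∀ i, p i ≠ 0) : TerminatesWithOptimalCode p ν s₀ := by
  obtain ⟨r, hL⟩ := hlight.exists_lightTail (Real.exp_pos _).le
  have ha : 1 < Real.exp s₀ := Real.one_lt_exp_iff.2 hs₀
  have hbdd : ∀ C, BddAbove (feasible p ν C) := fun C => ⟨s₀, hb C⟩
  refine terminatesWithOptimalCode_of hs₀.le hbdd
    (fun s hs => exists_minimizesPenalty_of_pos hpos hs) (fun s C hs hmin hexp => ?_)
    fun s C hrun => ?_
  · rcases (hs.le_of_isExponentBound hb).eq_or_lt with rfl | hlt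
    · exact hb
    refine isExponentBound_of_stop hν hmin hexp hbdd ⟨s₀, hlt, ?_⟩
    obtain ⟨σ, h1, h2, h3⟩ := exists_unary_lengths hL hpos hexp.nonneg hlt hmin
    have h4 : ∀ t, C.len (σ (t + (r + 4))) = C.len (σ (r + 4)) + t := by
      intro t
      induction t with
      | zero => simp
      | succ t ih =>
        rw [show t + 1 + (r + 4) = t + (r + 4) + 1 by ring, h2 _ (by omega), ih]; ring
    refine expSum_ne_top_of_summable ?_
    rw [← σ.summable_iff, ← summable_nat_add_iff (r + 4)]
    have h5 := (summable_nat_add_iff (r + 4)).2 hL.summable_mul_pow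
    have hx : Real.exp s₀ ^ (r + 4) ≠ 0 := by positivity
    refine (h5.mul_right (Real.exp s₀ ^ C.len (σ (r + 4)) / Real.exp s₀ ^ (r + 4))).congr
      fun t => ?_
    simp only [Function.comp_apply, h1, h4, pow_add _ t (r + 4), pow_add _ (C.len (σ (r + 4))) t]
    field_simp
  · let B : ℕ → ℕ := fun i => ⌊(cost p (Real.exp s₀) (fun t => t + 1) / p i).toReal⌋₊
    refine hrun.not_finite 1 (finite_setOf_eventually_period (M := r + 5) (k := 1)
      ((Finset.range (r + 5)).sup B) le_rfl (by omega)) fun j hj => ?_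
    obtain ⟨m, rfl⟩ : ∃ m, j = m + 1 := ⟨j - 1, by omega⟩
    have hlt : s (m + 1) < s₀ :=
      (hrun.strictMono (Nat.lt_succ_self m)).trans_le (hb _ (hrun.pass (m + 1)).exponent.1)
    have hmin := (hrun.pass (m + 1)).minimizes
    obtain ⟨σ, h1, h2, h3⟩ := exists_unary_lengths hL hpos (hrun.nonneg m) hlt hmin
    refine ⟨fun i => (C (m + 1 + 1)).len (σ i), ⟨fun i hi => ?_, fun i hi => h2 i (by omega)⟩, h3⟩
    have h5 := len_le_of_minimizesPenalty (S := s₀) kraftLE_succ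
      (hL.summable_penalty_succ (fun i => ENNReal.toReal_nonneg) ha) (hrun.nonneg m) hlt.le hmin
      (hpos (σ i))
    rw [h1] at h5
    exact h5.trans (Finset.le_sup (f := B) (Finset.mem_range.2 hi))

end Light

/-! ### Geometric sources -/

section Geometric

variable {p : PMF ℕ} {ν : Measure ℝ} [IsProbabilityMeasure ν] {s₀ : ℝ}

/-- For lengths `≈ i/k` with `k` large the penalty with a given base grows slower than `θ^{-i}`. -/
lemma exists_kraftLE_summable {θ : ℝ} (hθ0 : 0 < θ) (hθ1 : θ < 1) {b : ℝ} (hb : 1 ≤ b) :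
    ∃ g, KraftLE g ∧ Summable fun i => θ ^ i * penalty b (g i) := by
  obtain ⟨k, hk⟩ := exists_pow_lt_of_lt_one (show (0 : ℝ) < (b + 1)⁻¹ by positivity) hθ1
  have hk0 : k ≠ 0 := by
    rintro rfl
    rw [pow_zero] at hk
    have := inv_le_one_of_one_le₀ (show 1 ≤ b + 1 by linarith)
    linarith
  have hdiv : ∀ i : ℕ, k * (i / k) ≤ i ∧ i ≤ k * (i / k) + k := fun i => by
    have h1 := Nat.div_add_mod i k
    have h2 := Nat.mod_lt i (Nat.pos_of_ne_zero hk0)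
    omega
  -- `y` is the `k`-th root of `1/2`, and `x` that of `b + 1`
  obtain ⟨y, hy0, hy⟩ : ∃ y : ℝ, 0 ≤ y ∧ y ^ k = 2⁻¹ :=
    ⟨(2⁻¹ : ℝ) ^ (k⁻¹ : ℝ), by positivity, Real.rpow_inv_natCast_pow (by norm_num) hk0⟩
  obtain ⟨x, hx0, hx⟩ : ∃ x : ℝ, 0 ≤ x ∧ x ^ k = b + 1 :=
    ⟨(b + 1) ^ (k⁻¹ : ℝ), by positivity, Real.rpow_inv_natCast_pow (by linarith) hk0⟩
  have hy1 : y < 1 := by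
    by_contra h
    have := one_le_pow₀ (not_lt.1 h) (n := k)
    rw [hy] at this; norm_num at this
  have hx1 : 1 ≤ x := by
    by_contra h
    have := pow_le_one₀ hx0 (not_le.1 h).le (n := k)
    rw [hx] at this; linarith
  have hθx : θ * x < 1 := by
    by_contra h
    have := one_le_pow₀ (not_lt.1 h) (n := k)
    rw [mul_pow, hx] at this
    rw [lt_inv_comm₀ (by positivity) (by linarith), ← one_div, lt_div_iff₀ (by positivity)] at hk
    linarith
  have hmass : Summable fun i : ℕ => (2⁻¹ : ℝ) ^ (i / k) := by
    refine ((summable_geometric_of_lt_one hy0 hy1).mul_left 2).of_nonneg_of_le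
      (fun i => by positivity) fun i => ?_
    have h1 : y ^ (k * (i / k) + k) ≤ y ^ i := pow_le_pow_of_le_one hy0 hy1.le (hdiv i).2
    rw [pow_add, pow_mul, hy] at h1
    linarith
  obtain ⟨K, hK⟩ := exists_pow_lt_of_lt_one
    (show (0 : ℝ) < (∑' i : ℕ, (2⁻¹ : ℝ) ^ (i / k) + 1)⁻¹ by
      have : 0 ≤ ∑' i : ℕ, (2⁻¹ : ℝ) ^ (i / k) := tsum_nonneg fun i => by positivity
      positivity) (show (2⁻¹ : ℝ) < 1 by norm_num)
  refine ⟨fun i => K + i / k, ⟨?_, ?_⟩, ?_⟩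
  · simpa only [pow_add] using hmass.mul_left _
  · simp only [pow_add, tsum_mul_left]
    have h0 : 0 ≤ ∑' i : ℕ, (2⁻¹ : ℝ) ^ (i / k) := tsum_nonneg fun i => by positivity
    calc _ ≤ (∑' i : ℕ, (2⁻¹ : ℝ) ^ (i / k) + 1)⁻¹ * (∑' i : ℕ, (2⁻¹ : ℝ) ^ (i / k) + 1) := by
          gcongr; linarith
      _ = 1 := inv_mul_cancel₀ (by positivity)
  · refine ((summable_geometric_of_lt_one (by positivity) hθx).mul_left
      ((b + 1) ^ K / b)).of_nonneg_of_le
      (fun i => mul_nonneg (by positivity) (penalty_nonneg hb _)) fun i => ?_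
    have h1 := penalty_le_pow_div (a := b + 1) (by linarith) hb (by linarith) (K + i / k)
    have h2 : (b + 1) ^ (i / k) ≤ x ^ i := by
      rw [← hx, ← pow_mul]
      exact pow_le_pow_right₀ hx1 (hdiv i).1
    calc θ ^ i * penalty b (K + i / k) ≤ θ ^ i * ((b + 1) ^ (K + i / k) / (b + 1 - 1)) := by gcongr
      _ = (b + 1) ^ K / b * (θ ^ i * (b + 1) ^ (i / k)) := by
          rw [pow_add, add_sub_cancel_right]; ring
      _ ≤ (b + 1) ^ K / b * (θ * x) ^ i := by rw [mul_pow]; gcongr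

/-- If all symbols have positive probability, the exponents of all codes are bounded: the
intermission time is below some `t` with positive probability, and one of the first `2^t + 1`
codewords is longer than `t`. -/
lemma exists_feasible_bound (hpos : ∀ i, p i ≠ 0) :
    ∃ B, ∀ C : PrefixCode, ∀ s ∈ feasible p ν C, s ≤ B := by
  obtain ⟨t, ht⟩ : ∃ t : ℕ, ν (Set.Iic (t : ℝ)) ≠ 0 := by
    by_contra hcon
    push Not at hcon
    have h1 := measure_iUnion_null hcon
    have h2 : ⋃ t : ℕ, Set.Iic (t : ℝ) = Set.univ := by
      ext x
      simpa using exists_nat_ge x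
    rw [h2, measure_univ] at h1
    exact one_ne_zero h1
  obtain ⟨i₀, -, hi₀⟩ := Finset.exists_min_image (Finset.range (2 ^ t + 1)) (fun i => p i)
    ⟨0, by simp⟩
  have hne : ν (Set.Iic (t : ℝ)) * p i₀ ≠ ∞ :=
    ENNReal.mul_ne_top (measure_ne_top _ _) (p.apply_ne_top _)
  set δ := (ν (Set.Iic (t : ℝ)) * p i₀).toReal with hδ
  have hδ0 : 0 < δ := ENNReal.toReal_pos (mul_ne_zero ht (hpos i₀)) hne
  refine ⟨1 / δ, fun C s hs => ?_⟩
  rcases le_or_gt s 0 with hs0 | hs0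
  · exact hs0.trans (by positivity)
  obtain ⟨i, hi, hlen⟩ : ∃ i ∈ Finset.range (2 ^ t + 1), t + 1 ≤ C.len i := by
    by_contra hcon
    push Not at hcon
    have h1 := C.kraftLE.sum_le (Finset.range (2 ^ t + 1))
    have h2 : ∑ i ∈ Finset.range (2 ^ t + 1), (2⁻¹ : ℝ) ^ t ≤
        ∑ i ∈ Finset.range (2 ^ t + 1), (2⁻¹ : ℝ) ^ C.len i :=
      Finset.sum_le_sum fun i hi => pow_le_pow_of_le_one (by norm_num) (by norm_num)
        (by have := hcon i hi; omega)
    rw [Finset.sum_const, Finset.card_range, nsmul_eq_mul] at h2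
    push_cast at h2
    have h3 : (2 : ℝ) ^ t * 2⁻¹ ^ t = 1 := by rw [← mul_pow]; norm_num
    have h4 : (0 : ℝ) < 2⁻¹ ^ t := by positivity
    nlinarith
  have hA : ENNReal.ofReal (Real.exp (-s * t)) * ν (Set.Iic (t : ℝ)) ≤ laplaceStieltjes ν s := by
    refine le_trans ?_ (mul_meas_ge_le_lintegral₀ (by fun_prop)
      (ENNReal.ofReal (Real.exp (-s * t))))
    gcongr
    intro x hx
    refine ENNReal.ofReal_le_ofReal (Real.exp_le_exp.2 ?_)
    have : x ≤ t := hx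
    nlinarith
  have hE : p i₀ * ENNReal.ofReal (Real.exp (s * (t + 1))) ≤ expSum p C s := by
    refine le_trans (mul_le_mul' (hi₀ i hi) (ENNReal.ofReal_le_ofReal (Real.exp_le_exp.2 ?_)))
      (ENNReal.le_tsum i)
    have : ((t + 1 : ℕ) : ℝ) ≤ C.len i := by exact_mod_cast hlen
    push_cast at this
    gcongr
  have h1 : ENNReal.ofReal (δ * Real.exp s) ≤ 1 := by
    refine le_trans (le_of_eq ?_) ((mul_le_mul' hA hE).trans hs)
    have e : Real.exp s = Real.exp (-s * t) * Real.exp (s * (t + 1)) := by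
      rw [← Real.exp_add]; congr 1; ring
    rw [e, ENNReal.ofReal_mul hδ0.le, ENNReal.ofReal_mul (Real.exp_pos _).le,
      hδ, ENNReal.ofReal_toReal hne]
    ring
  rw [ENNReal.ofReal_le_one] at h1
  rw [le_div_iff₀ hδ0]
  have := Real.add_one_le_exp s
  nlinarith

lemma IsGeometricSource.exists_isGeomWeight (h : IsGeometricSource p) :
    ∃ θ, IsGeomWeight (fun i => (p i).toReal) θ := by
  obtain ⟨θ, h0, h1, hp⟩ := h
  have e : ∀ i, (p i).toReal = (1 - θ) * θ ^ i := fun i => by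
    rw [hp, ENNReal.toReal_ofReal (mul_nonneg (by linarith) (by positivity))]
  refine ⟨θ, h0, h1, fun i => ?_, fun i t => ?_⟩
  · rw [e]; exact mul_pos (by linarith) (by positivity)
  · rw [e, e, pow_add]; ring

lemma terminates_of_geometric (hν : ∀ᵐ t ∂ν, 0 ≤ t) (hs₀ : 0 < s₀) (hgeo : IsGeometricSource p) :
    TerminatesWithOptimalCode p ν s₀ := by
  obtain ⟨θ, hg⟩ := hgeo.exists_isGeomWeight
  have hθ := hg.theta_pos
  have hpos : ∀ i, p i ≠ 0 := fun i hi => by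
    have := hg.pos i
    simp [hi] at this
  obtain ⟨U, hU⟩ := exists_feasible_bound (ν := ν) hpos
  have hbdd : ∀ C, BddAbove (feasible p ν C) := fun C => ⟨U, hU C⟩
  have hcode : ∀ b : ℝ, 1 ≤ b → ∃ g, KraftLE g ∧ (Summable fun i => θ ^ i * penalty b (g i)) ∧
      Summable fun i => (p i).toReal * penalty b (g i) := by
    intro b hb
    obtain ⟨g, h1, h2⟩ := exists_kraftLE_summable hθ hg.theta_lt_one hb
    refine ⟨g, h1, h2, (h2.mul_left (p 0).toReal).congr fun i => ?_⟩
    have := hg.add 0 i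
    simp only [zero_add] at this
    rw [this]; ring
  refine terminatesWithOptimalCode_of hs₀.le hbdd
    (fun s hs => exists_minimizesPenalty_of_pos hpos hs) (fun s C hs hmin hexp => ?_)
    fun s C hrun => ?_
  · have hb : 1 ≤ Real.exp s := Real.one_le_exp hexp.nonneg
    obtain ⟨g, h1, h2, h3⟩ := hcode _ hb
    obtain ⟨b', hb', h4⟩ := hg.exists_gt_summable hb (summable_toReal_pmf p)
      (isOptLen_of_minimizesPenalty hexp.nonneg hmin h1 h3) h1 h2
    have hb'0 : 0 < b' := by linarith
    refine isExponentBound_of_stop hν hmin hexp hbdd ⟨Real.log b', ?_, ?_⟩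
    · exact (Real.lt_log_iff_exp_lt hb'0).2 hb'
    · refine expSum_ne_top_of_summable ?_
      rwa [Real.exp_log hb'0]
  · -- the values increase to a limit `S`; just below `e^S` the optimal period is constant
    have hmono := hrun.strictMono
    have hbd : BddAbove (Set.range fun j => s (j + 1)) :=
      ⟨U, by rintro _ ⟨j, rfl⟩; exact hU _ _ (hrun.pass j).exponent.1⟩
    have hlim := tendsto_atTop_ciSup hmono.monotone hbd
    set S := ⨆ j, s (j + 1) with hS
    have hlt : ∀ j, s (j + 1) < S := fun j =>
      (hmono (Nat.lt_succ_self j)).trans_le (le_ciSup hbd (j + 1))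
    have hS1 : 1 ≤ Real.exp S := Real.one_le_exp ((hrun.nonneg 0).trans (hlt 0).le)
    obtain ⟨g, h1, h2, h3⟩ := hcode _ hS1
    obtain ⟨k, hk1, hk2⟩ : ∃ k : ℕ, θ ^ (k + 1) * Real.exp S * (1 + θ) ≤ 1 ∧
        1 < θ ^ k * Real.exp S * (1 + θ) := by
      have hex : ∃ m : ℕ, θ ^ m * Real.exp S * (1 + θ) ≤ 1 := by
        obtain ⟨m, hm⟩ := exists_pow_lt_of_lt_one
          (show (0 : ℝ) < (Real.exp S * (1 + θ))⁻¹ by positivity) hg.theta_lt_one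
        refine ⟨m, ?_⟩
        rw [mul_assoc, ← le_div_iff₀ (by positivity), one_div]
        exact hm.le
      classical
      have hm0 : Nat.find hex ≠ 0 := by
        intro h0
        have := Nat.find_spec hex
        rw [h0, pow_zero] at this
        nlinarith
      obtain ⟨k, hk⟩ := Nat.exists_eq_succ_of_ne_zero hm0
      refine ⟨k, ?_, not_le.1 (Nat.find_min hex (by omega))⟩
      have := Nat.find_spec hex
      rwa [hk] at this
    have hev : ∀ᶠ j in atTop, 1 < θ ^ k * Real.exp (s (j + 1)) * (1 + θ) := by
      have hcont : Tendsto (fun j => θ ^ k * Real.exp (s (j + 1)) * (1 + θ)) atTop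
          (𝓝 (θ ^ k * Real.exp S * (1 + θ))) :=
        (((Real.continuous_exp.tendsto S).comp hlim).const_mul _).mul_const _
      exact hcont.eventually (lt_mem_nhds hk2)
    obtain ⟨J, hJ⟩ := eventually_atTop.1 hev
    let B : ℕ → ℕ := fun i => ⌊(cost p (Real.exp S) g / p i).toReal⌋₊
    refine hrun.not_finite (J + 1) (finite_setOf_eventually_period (M := 3 * k + 4) (k := k + 1)
      ((Finset.range (3 * k + 4)).sup B) (by omega) (by omega)) fun j hj => ?_
    obtain ⟨m, rfl⟩ : ∃ m, j = m + 1 := ⟨j - 1, by omega⟩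
    have hmin := (hrun.pass (m + 1)).minimizes
    have hs0 := hrun.nonneg m
    have hb1 : 1 ≤ Real.exp (s (m + 1)) := Real.one_le_exp hs0
    have hbS : Real.exp (s (m + 1)) < Real.exp S := Real.exp_lt_exp.2 (hlt m)
    refine ⟨(C (m + 1 + 1)).len, ⟨fun i hi => ?_, fun i hi => ?_⟩, fun t => rfl⟩
    · exact (len_le_of_minimizesPenalty h1 h3 hs0 (hlt m).le hmin (hpos i)).trans
        (Finset.le_sup (f := B) (Finset.mem_range.2 hi))
    · have hopt := isOptLen_of_minimizesPenalty hs0 hmin h1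
        (summable_mul_penalty_mono (fun i => (hg.pos i).le) hb1 hbS.le h3)
      refine hg.add_period hb1 hopt (lt_of_lt_of_le ?_ hk1) (hJ m (by omega)) (by omega)
      gcongr

end Geometric

theorem theorem3 (p : PMF ℕ) (ν : Measure ℝ) [IsProbabilityMeasure ν]
    (hν : ∀ᵐ t ∂ν, 0 ≤ t) (s₀ : ℝ) (hs₀ : 0 < s₀)
    (hp : IsGeometricSource p ∨ (IsLightTailed p (Real.exp s₀) ∧ IsExponentBound p ν s₀)) :
    TerminatesWithOptimalCode p ν s₀ := by
  rcases hp with hgeo | ⟨hlight, hb⟩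
  · exact terminates_of_geometric hν hs₀ hgeo
  · rcases hlight.pos_or_finite with hpos | hfin
    · exact terminates_of_lightTailed hν hs₀ hlight hb hpos
    · exact terminates_of_finite_support hν hs₀.le hb hfin
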